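/- Let $w\in S_n$ be a vexillary (i.e. $2143$-avoiding) permutation. **Notation.** The Rothe diagram of $w$ is $D(w)=\{(i,j)\in[n]\times[n]: i<w^{-1}(j),\ j<w(i)\}$ ($i$ is the row, numbered from top to bottom, $j$ the column), and $r_{D(w)}(i,j)=\#\{k<i: w(k)<j\}$ is the rank of $(i,j)\in D(w)$. A *bubbling diagram* is a triple $\mathcal D=(D,r,F)$ with $F\subseteq D\subseteq[n]\times[n]$ and $r\colon D\to\mathbb Z_{\ge0}$ such that (a) for each $(i,j)\in F$ there is $i'<i$ with $(i',j)\in D\setminus F$, and for the largest such $i'$ one has $r(i,j)-r(i',j)=i-i'$; (b) $r(i,j)\ne r(i,k)$ whenever $(i,j),(i,k)\in F$ and $j\neq k$. Squares in $D\setminus F$ are *live*, squares in $F$ *dead*, squares not in $D$ *empty*. The weight $\mathrm{wt}(D)\in\mathbb Z^n$ has as $i$-th entry the number of squares of $D$ in row $i$. If $(i,j)$ is live, $i>1$, and $(i-1,j)$ is empty, a *bubbling move* at $(i,j)$ replaces $(i,j)$ by the live square $(i-1,j)$ of rank $r(i,j)-1$. If moreover no dead square in row $i$ has rank $r(i,j)$,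 a *K-bubbling move* at $(i,j)$ adds the live square $(i-1,j)$ of rank $r(i,j)-1$ and makes $(i,j)$ dead, with unchanged rank. All other squares and ranks are unchanged. Let $\mathcal{BD}(w)$ be the set of bubbling diagrams obtained from $(D(w),r_{D(w)},\emptyset)$ by sequences of bubbling and K-bubbling moves. Order $D(w)$ by: $(i,j)\prec(i',j')$ if $i>i'$; or $i=i'$ and column $j$ of $D(w)$ has fewer squares below row $i$ than column $j'$ does; or $i=i'$, these numbers are equal, and $j<j'$. Two squares $(i,j),(i',j')$ of $D(w)$ are *linked* if $i-i'=r_{D(w)}(i,j)-r_{D(w)}(i',j')$. Let $A(w)$ be obtained by going through $D(w)$ in the order $\prec$ and selecting a square if and only if no square in its column and no square linked to it has been selected before. For $\mathcal D\in\mathcal{BD}(w)$, the *distinguished live squares* of $\mathcal D$ are, for each $a\in A(w)$, say the $m$-th highest square of $D(w)$ in column $j$, the $m$-th highest live square of $\mathcal D$ in column $j$. Let $\mathcal D^\top(w)=(D^\top(w),r^\top_{D(w)},F^\top(w))$ be obtained from $(D(w),r_{D(w)},\emptyset)$ by applying bubbling moves to squares lying above a distinguished live square of the same column until this is no longer possible,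 and then applying K-bubbling moves to distinguished live squares until this is no longer possible. **Theorem.** The bubbling diagram $\mathcal D^\top(w)$ is well defined: the procedure has a result, and it does not depend on the choices made. For any $\mathcal D=(D,r,F)\in\mathcal{BD}(w)$, there is $\mathcal D'=(D',r',F')\in\mathcal{BD}(w)$ with $F'=F^\top(w)$ and $x^{\mathrm{wt}(D)}\mid x^{\mathrm{wt}(D')}$. -/

import Mathlib

/-- A permutation is vexillary if it avoids the pattern `2143`. -/
def Vexillary {n : ℕ} (w : Equiv.Perm (Fin n)) : Prop :=
  ∀ i j k l : Fin n, i < j → j < k → k < l → ¬ (w j < w i ∧ w i < w l ∧ w l < w k)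

/-- A square `(i, j)`: row `i` (rows are numbered from top to bottom), column `j`. Indices start
at `0`. -/
abbrev Square (n k : ℕ) := Fin n × Fin k

/-- A bubbling diagram `(D, r, F)` in the `n × k` grid. The rank function is a function on `D`;
it is stored as a function on the whole grid which is `0` off `D`, so that two
bubbling diagrams are equal exactly when their `D`, their `F` and their ranks on `D` agree. -/
structure BubblingDiagram (n k : ℕ) where
  /-- all squares of the diagram -/
  D : Finset (Square n k)
  /-- the rank function -/
  r : Square n k → ℕ
  /-- the dead squares -/
  F : Finset (Square n k)
  r_off : ∀ x, x ∉ D → r x = 0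
  F_subset : F ⊆ D
  /-- Above a dead square there is a live square in the same column, and the lowest such live
  square has rank smaller by the difference of the rows. -/
  dead_below_live : ∀ i j, (i, j) ∈ F →
    ∃ i', i' < i ∧ (i', j) ∈ D \ F ∧ (∀ i'', i' < i'' → i'' < i → (i'', j) ∉ D \ F) ∧
      (r (i, j) : ℤ) - (r (i', j) : ℤ) = ((i : ℕ) : ℤ) - ((i' : ℕ) : ℤ)
  /-- Two different dead squares in the same row have different ranks. -/
  dead_rank_ne : ∀ i j j', j ≠ j' → (i, j) ∈ F → (i, j') ∈ F → r (i, j) ≠ r (i, j')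

namespace BubblingDiagram

variable {n k : ℕ}

/-- The live squares. -/
def live (𝒟 : BubblingDiagram n k) : Finset (Square n k) := 𝒟.D \ 𝒟.F

/-- The weight of a bubbling diagram: the `i`-th entry is the number of squares (live or dead)
in row `i`. -/
noncomputable def wt (𝒟 : BubblingDiagram n k) : Fin n →₀ ℕ :=
  Finsupp.equivFunOnFinite.symm fun i => (𝒟.D.filter fun x => x.1 = i).card

/-- `𝒟'` is obtained from `𝒟` by a bubbling move at the live square `(i, j)`; here `i'` is the
row directly above row `i`. -/
def BubblingMove (𝒟 : BubblingDiagram n k) (i : Fin n) (j : Fin k)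
    (𝒟' : BubblingDiagram n k) : Prop :=
  (i, j) ∈ 𝒟.live ∧ ∃ i' : Fin n, (i' : ℕ) + 1 = (i : ℕ) ∧ (i', j) ∉ 𝒟.D ∧
    𝒟'.D = insert (i', j) (𝒟.D.erase (i, j)) ∧
    𝒟'.r (i', j) + 1 = 𝒟.r (i, j) ∧
    (∀ x ∈ 𝒟'.D, x ≠ (i', j) → 𝒟'.r x = 𝒟.r x) ∧
    𝒟'.F = 𝒟.F

/-- `𝒟'` is obtained from `𝒟` by a K-bubbling move at the live square `(i, j)`; here `i'` is the
row directly above row `i`. -/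
def KBubblingMove (𝒟 : BubblingDiagram n k) (i : Fin n) (j : Fin k)
    (𝒟' : BubblingDiagram n k) : Prop :=
  (i, j) ∈ 𝒟.live ∧ (∀ l : Fin k, (i, l) ∈ 𝒟.F → 𝒟.r (i, j) ≠ 𝒟.r (i, l)) ∧
    ∃ i' : Fin n, (i' : ℕ) + 1 = (i : ℕ) ∧ (i', j) ∉ 𝒟.D ∧
      𝒟'.D = insert (i', j) 𝒟.D ∧
      𝒟'.r (i', j) + 1 = 𝒟.r (i, j) ∧
      (∀ x ∈ 𝒟'.D, x ≠ (i', j) → 𝒟'.r x = 𝒟.r x) ∧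
      𝒟'.F = insert (i, j) 𝒟.F

/-- One move of either kind. -/
def Move (𝒟 𝒟' : BubblingDiagram n k) : Prop :=
  ∃ i j, BubblingMove 𝒟 i j 𝒟' ∨ KBubblingMove 𝒟 i j 𝒟'

/-- All bubbling diagrams generated from `𝒟` by a series of bubbling and K-bubbling moves. -/
def BD (𝒟 : BubblingDiagram n k) : Set (BubblingDiagram n k) :=
  {𝒟' | Relation.ReflTransGen Move 𝒟 𝒟'}

end BubblingDiagram

/-- The Rothe diagram `{(i, j) : i < w⁻¹(j), j < w(i)}`. -/
def rotheDiagram {n : ℕ} (w : Equiv.Perm (Fin n)) : Finset (Square n n) :=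
  Finset.univ.filter fun x => x.1 < w.symm x.2 ∧ x.2 < w x.1

/-- The rank of a square `(i, j)` with respect to `w`: the number of `k < i` with `w(k) < j`. -/
def rotheRank {n : ℕ} (w : Equiv.Perm (Fin n)) (x : Square n n) : ℕ :=
  (Finset.univ.filter fun k : Fin n => k < x.1 ∧ w k < x.2).card

/-- The Rothe bubbling diagram `(D(w), r_{D(w)}, ∅)`. -/
def rotheBubblingDiagram {n : ℕ} (w : Equiv.Perm (Fin n)) : BubblingDiagram n n where
  D := rotheDiagram w
  r x := if x ∈ rotheDiagram w then rotheRank w x else 0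
  F := ∅
  r_off x hx := by simp [hx]
  F_subset := by simp
  dead_below_live := by simp
  dead_rank_ne := by simp

/-- The set `BD(w)` of bubbling diagrams of `w`. -/
def bubblingDiagrams {n : ℕ} (w : Equiv.Perm (Fin n)) : Set (BubblingDiagram n n) :=
  (rotheBubblingDiagram w).BD

/-- Two squares of the Rothe diagram are linked if the difference of their rows is the
difference of their ranks. -/
def RotheLinked {n : ℕ} (w : Equiv.Perm (Fin n)) (x y : Square n n) : Prop :=
  ((x.1 : ℕ) : ℤ) - ((y.1 : ℕ) : ℤ) = (rotheRank w x : ℤ) - (rotheRank w y : ℤ)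

instance {n : ℕ} (w : Equiv.Perm (Fin n)) (x y : Square n n) : Decidable (RotheLinked w x y) :=
  inferInstanceAs (Decidable (_ = _))

/-- The number of squares of `D(w)` below `x` in the column of `x`. -/
def numBelow {n : ℕ} (w : Equiv.Perm (Fin n)) (x : Square n n) : ℕ :=
  ((rotheDiagram w).filter fun y => y.2 = x.2 ∧ x.1 < y.1).card

/-- The order `≺` on squares: lower rows first; in a row, squares with fewer squares below them
first; ties are broken from left to right. -/
def Prec {n : ℕ} (w : Equiv.Perm (Fin n)) (x y : Square n n) : Prop :=
  y.1 < x.1 ∨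
  (x.1 = y.1 ∧ numBelow w x < numBelow w y) ∨
  (x.1 = y.1 ∧ numBelow w x = numBelow w y ∧ x.2 < y.2)

/-- The reflexive closure of `≺`. -/
def PrecEq {n : ℕ} (w : Equiv.Perm (Fin n)) (x y : Square n n) : Prop := x = y ∨ Prec w x y

instance {n : ℕ} (w : Equiv.Perm (Fin n)) : DecidableRel (PrecEq w) := fun x y =>
  inferInstanceAs (Decidable (x = y ∨ (y.1 < x.1 ∨ (x.1 = y.1 ∧ numBelow w x < numBelow w y) ∨
    (x.1 = y.1 ∧ numBelow w x = numBelow w y ∧ x.2 < y.2))))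

instance {n : ℕ} (w : Equiv.Perm (Fin n)) : IsTrans (Square n n) (PrecEq w) where
  trans := by
    rintro ⟨a, a'⟩ ⟨b, b'⟩ ⟨c, c'⟩ h₁ h₂
    simp only [PrecEq, Prec, Prod.mk.injEq] at *
    grind

instance {n : ℕ} (w : Equiv.Perm (Fin n)) : Std.Antisymm (PrecEq w) where
  antisymm := by
    rintro ⟨a, a'⟩ ⟨b, b'⟩ h₁ h₂
    simp only [PrecEq, Prec, Prod.mk.injEq] at *
    grind

instance {n : ℕ} (w : Equiv.Perm (Fin n)) : Std.Total (PrecEq w) where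
  total := by
    rintro ⟨a, a'⟩ ⟨b, b'⟩
    simp only [PrecEq, Prec, Prod.mk.injEq]
    grind

/-- One step of the greedy selection: append `x` to the list `A` unless `A` already contains a
square in the same column or in the same linking class. -/
def selectStep {n : ℕ} (w : Equiv.Perm (Fin n)) (A : List (Square n n)) (x : Square n n) :
    List (Square n n) :=
  if ∃ a ∈ A, a.2 = x.2 ∨ RotheLinked w a x then A else A ++ [x]

/-- The ordered set `A(w)` of distinguished live squares: go through `D(w)` in the order `≺` and
select greedily. -/
def distinguishedSquares {n : ℕ} (w : Equiv.Perm (Fin n)) : List (Square n n) :=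
  ((rotheDiagram w).sort (PrecEq w)).foldl (selectStep w) []

/-- The position, counted from the top, of a square `x ∈ S` among the squares of `S` in the
column of `x` (the highest one has position `1`). -/
def heightIndex {n k : ℕ} (S : Finset (Square n k)) (x : Square n k) : ℕ :=
  (S.filter fun y => y.2 = x.2 ∧ y.1 ≤ x.1).card

/-- `x ∈ A(𝒟)`: for some `a ∈ A(w)`, say the `m`-th highest square of `D(w)` in its column, `x` is
the `m`-th highest live square of `𝒟` in that column. -/
def IsDistinguished {n : ℕ} (w : Equiv.Perm (Fin n)) (𝒟 : BubblingDiagram n n)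
    (x : Square n n) : Prop :=
  x ∈ 𝒟.live ∧ ∃ a ∈ distinguishedSquares w, a.2 = x.2 ∧
    heightIndex 𝒟.live x = heightIndex (rotheDiagram w) a

/-- A bubbling move at a square lying above a distinguished live square (of the same column). -/
def TopBubblingStep {n : ℕ} (w : Equiv.Perm (Fin n)) (𝒟 𝒟' : BubblingDiagram n n) : Prop :=
  ∃ i j, (∃ i₀, i < i₀ ∧ IsDistinguished w 𝒟 (i₀, j)) ∧ 𝒟.BubblingMove i j 𝒟'

/-- A K-bubbling move at a distinguished live square. -/
def TopKBubblingStep {n : ℕ} (w : Equiv.Perm (Fin n)) (𝒟 𝒟' : BubblingDiagram n n) : Prop :=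
  ∃ i j, IsDistinguished w 𝒟 (i, j) ∧ 𝒟.KBubblingMove i j 𝒟'

/-- `𝒯` is a result of the construction of `𝒟^⊤(w)`: start from the Rothe bubbling diagram, apply
bubbling moves to squares above distinguished live squares until this is no longer possible, and
then K-bubbling moves to distinguished live squares until this is no longer possible. -/
def IsTopDiagram {n : ℕ} (w : Equiv.Perm (Fin n)) (𝒯 : BubblingDiagram n n) : Prop :=
  ∃ ℰ : BubblingDiagram n n,
    Relation.ReflTransGen (TopBubblingStep w) (rotheBubblingDiagram w) ℰ ∧
    (∀ 𝒟', ¬ TopBubblingStep w ℰ 𝒟') ∧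
    Relation.ReflTransGen (TopKBubblingStep w) ℰ 𝒯 ∧
    (∀ 𝒟', ¬ TopKBubblingStep w 𝒯 𝒟')

/-
In a column of the Rothe diagram the row of a square exceeds its rank by the number of squares above
it, its *level*, and moves preserve levels. A bubbling diagram obtained by moves is therefore the
same as a configuration of columns, each a strictly increasing sequence of live rows together with
dead rows between them, no two dead squares in a row having the same level. Conversely, undoing
moves shows that every configuration satisfying the obvious bounds can be reached.

In this language the result of the construction of `𝒟^⊤(w)` can be written down: the live squares of
a distinguished column down to the distinguished one are at the top, and the dead squares fill the
rows from there down to the original row of the distinguished square.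

For the divisibility, the distinguished squares are treated in the greedy order. By vexillarity the
squares of `D(w)` are nested enough that, for the next distinguished square, its column and any
column carrying dead squares of the same level can exchange parts so that these dead squares end up
in the distinguished column, and no row loses squares. Once all distinguished squares are filled up,
the greedy selection leaves no room for further dead squares.
-/

theorem add_sub_le_of_strictMono {p : ℕ → ℕ} (hp : StrictMono p) {a b : ℕ} (h : a ≤ b) :
    p a + (b - a) ≤ p b := by
  have := hp.add_le_nat (b - a) a
  rwa [Nat.sub_add_cancel h, add_comm] at this

theorem eq_add_sub_of_forall_succ {p : ℕ → ℕ} {l m : ℕ}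
    (h : ∀ k, l ≤ k → k < m → p (k + 1) = p k + 1) (hl : l ≤ m) : p m = p l + (m - l) := by
  induction m, hl using Nat.le_induction with
  | base => simp
  | succ m hlm ih =>
    rw [h m hlm m.lt_succ_self, ih fun k hlk hkm => h k hlk (hkm.trans m.lt_succ_self),
      Nat.succ_sub hlm, add_assoc]

/-- A column of a bubbling diagram. The `l`-th live square (counted from `0`) is in row `row l`,
and `dead l i` says that row `i` contains a dead square lying between the live squares `l` and
`l + 1`. The index `l` is the *level* of these squares; in a column of the Rothe diagram the row
exceeds the rank by exactly the level, so moves preserve levels. There are infinitely many live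
squares; those beyond the grid are sentinels. -/
@[ext]
structure Column where
  row : ℕ → ℕ
  dead : ℕ → ℕ → Prop

namespace Column

variable {p p₁ p₂ : ℕ → ℕ} {n m : ℕ} {c c₁ c₂ : Column}

/-- Row `i` contains a square of level `l`, live or dead. -/
def At (c : Column) (l i : ℕ) : Prop := c.row l = i ∨ c.dead l i

/-- Row `i` contains a square, live or dead. -/
def Occupied (c : Column) (i : ℕ) : Prop := ∃ l, c.At l i

/-- `c` can be reached from the column whose `l`-th live square is in row `p l`, as far as this
column alone is concerned. Live squares starting in row `n` or below are immobile. -/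
structure IsAdmissible (p : ℕ → ℕ) (n : ℕ) (c : Column) : Prop where
  row_lt_row_succ : ∀ l, c.row l < c.row (l + 1)
  row_le : ∀ l, c.row l ≤ p l
  row_eq : ∀ l, n ≤ p l → c.row l = p l
  dead_bounds : ∀ l i, c.dead l i → c.row l < i ∧ i ≤ p l ∧ i < c.row (l + 1)

namespace IsAdmissible

theorem strictMono (h : c.IsAdmissible p n) : StrictMono c.row :=
  strictMono_nat_of_lt_succ h.row_lt_row_succ

theorem self_le_row (h : c.IsAdmissible p n) (l : ℕ) : l ≤ c.row l := h.strictMono.le_apply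

theorem lt_of_dead (h : c.IsAdmissible p n) {l i : ℕ} (hd : c.dead l i) : p l < n := by
  by_contra! hn
  have := h.row_eq l hn
  have := h.dead_bounds l i hd
  omega

theorem bounds_of_at (h : c.IsAdmissible p n) {l i : ℕ} (hi : c.At l i) :
    c.row l ≤ i ∧ i < c.row (l + 1) ∧ i ≤ p l := by
  obtain rfl | hd := hi
  · exact ⟨le_rfl, h.row_lt_row_succ l, h.row_le l⟩
  · exact (h.dead_bounds l i hd).imp_left le_of_lt |>.imp_right And.symm

theorem level_lt (h : c.IsAdmissible p n) {l m i : ℕ} (hi : c.At l i) (him : i < c.row m) :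
    l < m :=
  h.strictMono.lt_iff_lt.1 ((h.bounds_of_at hi).1.trans_lt him)

theorem le_level (h : c.IsAdmissible p n) {l m i : ℕ} (hi : c.At l i) (him : c.row m ≤ i) :
    m ≤ l :=
  Nat.lt_succ_iff.1 (h.strictMono.lt_iff_lt.1 (him.trans_lt (h.bounds_of_at hi).2.1))

theorem level_unique (h : c.IsAdmissible p n) {l l' i : ℕ} (hl : c.At l i) (hl' : c.At l' i) :
    l = l' :=
  (h.le_level hl' (h.bounds_of_at hl).1).antisymm (h.le_level hl (h.bounds_of_at hl').1)

theorem not_dead_row (h : c.IsAdmissible p n) {l l' : ℕ} : ¬ c.dead l (c.row l') := by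
  intro hd
  obtain rfl := h.level_unique (Or.inr hd) (Or.inl rfl)
  exact (h.dead_bounds _ _ hd).1.false

end IsAdmissible

/-- The row of the live square `m + 1` becomes a dead row of level `m`; the live squares after `m`
move down as far as necessary. -/
def push (c : Column) (m : ℕ) : Column where
  row l := if l ≤ m then c.row l else max (c.row l) (c.row (m + 1) + (l - m))
  dead l i := c.dead l i ∨ l = m ∧ i = c.row (m + 1)

theorem IsAdmissible.push (h : c.IsAdmissible p n) (hp : StrictMono p)
    (hm : c.row (m + 1) ≤ p m) (hd : ∀ l i, m < l → ¬ c.dead l i) :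
    (c.push m).IsAdmissible p n := by
  have hpush : ∀ l, m < l → c.row (m + 1) + (l - m) ≤ p l := fun l hl =>
    (Nat.add_le_add_right hm _).trans (add_sub_le_of_strictMono hp hl.le)
  constructor <;> intro l <;> dsimp only [Column.push] <;> have := h.row_lt_row_succ l <;>
    have := h.row_le l
  · grind
  · grind
  · have := h.row_eq l
    grind
  · have := h.dead_bounds l
    grind

theorem IsAdmissible.occupied_push (h : c.IsAdmissible p n) {i : ℕ} (hi : c.Occupied i) :
    (c.push m).Occupied i := by
  obtain ⟨l, rfl | hd⟩ := hi
  · rcases le_or_gt l m with hl | hl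
    · exact ⟨l, Or.inl (if_pos hl)⟩
    rcases le_or_gt (c.row (m + 1) + (l - m)) (c.row l) with hle | hlt
    · exact ⟨l, Or.inl ((if_neg hl.not_ge).trans (max_eq_left hle))⟩
    obtain rfl | hl := Nat.eq_or_lt_of_le hl
    · exact ⟨m, Or.inr (Or.inr ⟨rfl, rfl⟩)⟩
    -- the live square `l - 1` is pushed to the row left by the live square `l`
    · have h₁ := add_sub_le_of_strictMono h.strictMono hl.le
      have h₂ := h.strictMono (Nat.sub_one_lt_of_lt hl)
      refine ⟨l - 1, Or.inl ?_⟩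
      simp only [Column.push]
      grind
  · exact ⟨l, Or.inr (Or.inl hd)⟩

/-- In each row, the columns `d₁` and `d₂` together have at least as many squares as the columns
`c₁` and `c₂`. -/
structure PairLE (c₁ c₂ d₁ d₂ : Column) : Prop where
  both : ∀ i, c₁.Occupied i → c₂.Occupied i → d₁.Occupied i ∧ d₂.Occupied i
  either : ∀ i, c₁.Occupied i ∨ c₂.Occupied i → d₁.Occupied i ∨ d₂.Occupied i

section ExchangeBelow

/-- The first column after an exchange of the parts of `c₁` and `c₂` below level `m`: it receives
the lower live squares, and the dead squares of level `m` of `c₂` from the row of the live square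
`m + 1` of `c₁` on. -/
def exchangeBelowFst (c₁ c₂ : Column) (m : ℕ) : Column where
  row l := if l ≤ m then c₁.row l else max (c₁.row l) (c₂.row l)
  dead l i := c₁.dead l i ∨ l = m ∧ c₂.dead m i ∧ c₁.row (m + 1) ≤ i

/-- The second column after an exchange of the parts of `c₁` and `c₂` below level `m`. -/
def exchangeBelowSnd (c₁ c₂ : Column) (m : ℕ) : Column where
  row l := if l ≤ m then c₂.row l else min (c₁.row l) (c₂.row l)
  dead l i := c₂.dead l i ∧ ¬ (l = m ∧ c₁.row (m + 1) ≤ i)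

theorem row_le_row_of_immobile (h₁ : c₁.IsAdmissible p₁ n) (h₂ : c₂.IsAdmissible p₂ n)
    (hp : ∀ l, p₂ l ≤ p₁ l) {l : ℕ} (hl : n ≤ p₁ l) : c₂.row l ≤ c₁.row l :=
  (h₁.row_eq l hl).symm ▸ (h₂.row_le l).trans (hp l)

theorem IsAdmissible.exchangeBelowFst (h₁ : c₁.IsAdmissible p₁ n) (h₂ : c₂.IsAdmissible p₂ n)
    (hp : ∀ l, p₂ l ≤ p₁ l) (hd₁ : ∀ l i, m < l → ¬ c₁.dead l i) :
    (exchangeBelowFst c₁ c₂ m).IsAdmissible p₁ n := by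
  constructor <;> intro l <;> dsimp only [Column.exchangeBelowFst] <;>
    have := h₁.row_lt_row_succ l <;> have := h₂.row_lt_row_succ l
  · grind
  · grind [h₁.row_le l, h₂.row_le l]
  · intro hl
    grind [h₁.row_eq l hl, row_le_row_of_immobile h₁ h₂ hp hl]
  · have := h₁.dead_bounds l
    have := h₂.dead_bounds l
    grind

theorem IsAdmissible.exchangeBelowSnd (h₁ : c₁.IsAdmissible p₁ n) (h₂ : c₂.IsAdmissible p₂ n)
    (hp : ∀ l, p₂ l ≤ p₁ l) (hd₂ : ∀ l i, m < l → p₁ l < n → ¬ c₂.dead l i)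
    (hm : c₂.dead m (c₁.row (m + 1))) :
    (exchangeBelowSnd c₁ c₂ m).IsAdmissible p₂ n := by
  have hmb := h₂.dead_bounds _ _ hm
  constructor <;> intro l <;> dsimp only [Column.exchangeBelowSnd] <;>
    have := h₁.row_lt_row_succ l <;> have := h₂.row_lt_row_succ l
  · grind
  · grind [h₂.row_le l]
  · intro hl
    grind [h₂.row_eq l hl, row_le_row_of_immobile h₁ h₂ hp (hl.trans (hp l))]
  · intro i ⟨hi, hne⟩
    have := h₂.dead_bounds l i hi
    rcases lt_trichotomy l m with hl | rfl | hl
    · grind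
    · grind
    · have hn : n ≤ p₁ l := not_lt.1 fun hn => hd₂ l i hl hn hi
      have hn' : n ≤ p₁ (l + 1) := by grind [h₁.row_eq l, h₁.row_le (l + 1)]
      grind [row_le_row_of_immobile h₁ h₂ hp hn, row_le_row_of_immobile h₁ h₂ hp hn']

theorem IsAdmissible.occupied_exchangeBelow_of_lt (h₁ : c₁.IsAdmissible p₁ n)
    (h₂ : c₂.IsAdmissible p₂ n) (hm : c₂.dead m (c₁.row (m + 1))) {i : ℕ}
    (hi : i < c₁.row (m + 1)) (hi₁ : c₁.Occupied i) (hi₂ : c₂.Occupied i) :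
    (Column.exchangeBelowFst c₁ c₂ m).Occupied i ∧
    (Column.exchangeBelowSnd c₁ c₂ m).Occupied i := by
  obtain ⟨l, hl⟩ := hi₁
  obtain ⟨k, hk⟩ := hi₂
  have hlm : l ≤ m := Nat.lt_succ_iff.1 (h₁.level_lt hl hi)
  have hkm : k ≤ m :=
    Nat.lt_succ_iff.1 (h₂.level_lt hk (hi.trans (h₂.dead_bounds _ _ hm).2.2))
  refine ⟨⟨l, hl.imp (fun hl => (if_pos hlm).trans hl) Or.inl⟩,
    ⟨k, hk.imp (fun hk => (if_pos hkm).trans hk) fun hk => ⟨hk, fun h => ?_⟩⟩⟩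
  exact h.2.not_gt hi

theorem IsAdmissible.occupied_exchangeBelow_of_le (h₁ : c₁.IsAdmissible p₁ n)
    (h₂ : c₂.IsAdmissible p₂ n) (hd₁ : ∀ l i, m < l → ¬ c₁.dead l i)
    (hd₂ : ∀ l i, m < l → p₁ l < n → ¬ c₂.dead l i) (hm : c₂.dead m (c₁.row (m + 1))) {i : ℕ}
    (hi : c₁.row (m + 1) ≤ i) (hi₁ : c₁.Occupied i) (hi₂ : c₂.Occupied i) :
    (Column.exchangeBelowFst c₁ c₂ m).Occupied i ∧
    (Column.exchangeBelowSnd c₁ c₂ m).Occupied i := by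
  obtain ⟨l, hl⟩ := hi₁
  obtain ⟨k, hk⟩ := hi₂
  have hml : m < l := h₁.le_level hl hi
  have hl : c₁.row l = i := hl.resolve_right (hd₁ l i hml)
  have hmk : m ≤ k := h₂.le_level hk ((h₂.dead_bounds _ _ hm).1.le.trans hi)
  simp only [Occupied, At, Column.exchangeBelowFst, Column.exchangeBelowSnd]
  rcases hk with hk | hk
  · have hmk : m < k := hmk.lt_of_ne fun h => by grind [h₂.dead_bounds _ _ hm]
    rcases lt_trichotomy l k with hlk | rfl | hkl
    · have := h₁.strictMono hlk
      have := h₂.strictMono hlk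
      exact ⟨⟨l, by grind⟩, ⟨k, by grind⟩⟩
    · exact ⟨⟨l, by grind⟩, ⟨l, by grind⟩⟩
    · have := h₁.strictMono hkl
      have := h₂.strictMono hkl
      exact ⟨⟨k, by grind⟩, ⟨l, by grind⟩⟩
  · have hkb := h₂.dead_bounds _ _ hk
    obtain rfl | hmk := hmk.eq_or_lt
    · have := h₂.strictMono.monotone (show m + 1 ≤ l from hml)
      exact ⟨⟨m, by grind⟩, ⟨l, by grind⟩⟩
    · have hkn : n ≤ p₁ k := not_lt.1 fun hn => hd₂ k i hmk hn hk
      have hlk : l < k := h₁.level_lt (Or.inl hl) (by grind [h₁.row_eq k hkn, h₂.lt_of_dead hk])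
      have := h₂.strictMono hlk
      exact ⟨⟨l, by grind⟩, ⟨k, by grind⟩⟩

theorem occupied_exchangeBelow_or {i : ℕ} (hi : c₁.Occupied i ∨ c₂.Occupied i) :
    (exchangeBelowFst c₁ c₂ m).Occupied i ∨ (exchangeBelowSnd c₁ c₂ m).Occupied i := by
  simp only [Occupied, At, exchangeBelowFst, exchangeBelowSnd, ← exists_or] at hi ⊢
  obtain ⟨l, hl⟩ := hi
  exact ⟨l, by grind⟩

theorem IsAdmissible.pairLE_exchangeBelow (h₁ : c₁.IsAdmissible p₁ n)
    (h₂ : c₂.IsAdmissible p₂ n) (hd₁ : ∀ l i, m < l → ¬ c₁.dead l i)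
    (hd₂ : ∀ l i, m < l → p₁ l < n → ¬ c₂.dead l i) (hm : c₂.dead m (c₁.row (m + 1))) :
    PairLE c₁ c₂ (Column.exchangeBelowFst c₁ c₂ m) (Column.exchangeBelowSnd c₁ c₂ m) where
  both i hi₁ hi₂ := (lt_or_ge i (c₁.row (m + 1))).elim
    (fun hi => h₁.occupied_exchangeBelow_of_lt h₂ hm hi hi₁ hi₂)
    (fun hi => h₁.occupied_exchangeBelow_of_le h₂ hd₁ hd₂ hm hi hi₁ hi₂)
  either _ := occupied_exchangeBelow_or

end ExchangeBelow

section ExchangeAbove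

/-- The relation between the initial rows `p₁` and `p₂` of two columns that permits an exchange of
their parts above level `m`: `p₂` is nowhere below `p₁`, and once it differs from `p₁` the live
squares up to level `m + 1` are consecutive. -/
structure Dominates (p₁ p₂ : ℕ → ℕ) (m : ℕ) : Prop where
  le : ∀ l, p₂ l ≤ p₁ l
  eq_or_consecutive : ∀ l ≤ m, p₂ l = p₁ l ∨ ∀ k, l ≤ k → k ≤ m → p₂ (k + 1) = p₂ k + 1

/-- The row from which on an exchange above level `m` makes all squares of the first column dead,
down to row `b`; here `c` is the second column. -/
def fillStart (c : Column) (m b : ℕ) : ℕ := min (c.row (m + 1)) (b + 1)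

/-- The rows of the live squares of the first column after an exchange above level `m`. -/
def upperMin (c₁ c₂ : Column) (m l : ℕ) : ℕ :=
  if l ≤ m then min (c₁.row l) (c₂.row l) else c₁.row l

/-- The rows of the live squares of the second column after an exchange above level `m`. They are
cut off so that the `m`-th one lies above `fillStart c₂ m b`. -/
def upperMax (c₁ c₂ : Column) (m b l : ℕ) : ℕ :=
  if l ≤ m then min (max (c₁.row l) (c₂.row l)) (fillStart c₂ m b - (m + 1) + l) else c₂.row l

/-- The second column after an exchange of the parts of `c₁` and `c₂` above level `m`. It gives up
its dead squares of level `m`. -/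
def exchangeAboveSnd (c₁ c₂ : Column) (m b : ℕ) : Column where
  row := upperMax c₁ c₂ m b
  dead l i :=
    l < m ∧ (c₁.dead l i ∨ c₂.dead l i) ∧ upperMax c₁ c₂ m b l < i ∧
      i < upperMax c₁ c₂ m b (l + 1) ∨
    m < l ∧ c₂.dead l i

/-- The first column after an exchange of the parts of `c₁` and `c₂` above level `m`. It receives
all dead squares of level `m` and is filled with new ones down to row `b`. -/
def exchangeAboveFst (c₁ c₂ : Column) (m b : ℕ) : Column where
  row := upperMin c₁ c₂ m
  dead l i :=
    l < m ∧ (c₁.dead l i ∨ c₂.dead l i) ∧ upperMin c₁ c₂ m l < i ∧ i < upperMin c₁ c₂ m (l + 1) ∧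
      ¬ (exchangeAboveSnd c₁ c₂ m b).dead l i ∨
    l = m ∧ (c₁.dead m i ∨ c₂.dead m i ∨ fillStart c₂ m b ≤ i ∧ i ≤ b)

theorem not_dead_exchangeAboveSnd_of_dead_exchangeAboveFst {b l i : ℕ}
    (h : (exchangeAboveFst c₁ c₂ m b).dead l i) : ¬ (exchangeAboveSnd c₁ c₂ m b).dead l i := by
  obtain ⟨-, -, -, -, h⟩ | ⟨rfl, -⟩ := h
  · exact h
  · rintro (⟨h, -⟩ | ⟨h, -⟩) <;> exact h.false

/-- Two columns whose parts above level `m` can be exchanged. -/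
structure Exchangeable (p₁ p₂ : ℕ → ℕ) (n m : ℕ) (c₁ c₂ : Column) : Prop where
  fst : c₁.IsAdmissible p₁ n
  snd : c₂.IsAdmissible p₂ n
  strictMono : StrictMono p₁
  dominates : Dominates p₁ p₂ m
  lt : p₁ m < n
  lt_row : p₁ m < c₁.row (m + 1)
  not_dead : ∀ l i, m < l → ¬ c₁.dead l i
  disjoint : ∀ l i, c₁.dead l i → ¬ c₂.dead l i

namespace Exchangeable

theorem row_lt_fillStart (h : Exchangeable p₁ p₂ n m c₁ c₂) : c₂.row m < fillStart c₂ m (p₁ m) :=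
  lt_min (h.snd.row_lt_row_succ m)
    (Nat.lt_succ_of_le ((h.snd.row_le m).trans (h.dominates.le m)))

theorem succ_le_fillStart (h : Exchangeable p₁ p₂ n m c₁ c₂) :
    m + 1 ≤ fillStart c₂ m (p₁ m) :=
  (h.snd.self_le_row m).trans_lt h.row_lt_fillStart

theorem upperMax_le (h : Exchangeable p₁ p₂ n m c₁ c₂) (l : ℕ) :
    upperMax c₁ c₂ m (p₁ m) l ≤ p₂ l := by
  have := h.snd.row_le l
  unfold upperMax
  split_ifs with hl
  · obtain heq | hsucc := h.dominates.eq_or_consecutive l hl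
    · have := h.fst.row_le l
      omega
    · have hcut : fillStart c₂ m (p₁ m) ≤ p₂ (m + 1) := (min_le_left _ _).trans (h.snd.row_le _)
      have := eq_add_sub_of_forall_succ (p := p₂) (l := l) (m := m + 1)
        (fun k hlk hkm => hsucc k hlk (Nat.lt_succ_iff.1 hkm)) (by omega)
      have := h.succ_le_fillStart
      omega
  · exact this

theorem lt_level_of_immobile (h : Exchangeable p₁ p₂ n m c₁ c₂) {l : ℕ} (hl : n ≤ p₁ l) : m < l :=
  h.strictMono.lt_iff_lt.1 (h.lt.trans_le hl)

theorem isAdmissible_exchangeAboveSnd (h : Exchangeable p₁ p₂ n m c₁ c₂) :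
    (exchangeAboveSnd c₁ c₂ m (p₁ m)).IsAdmissible p₂ n where
  row_lt_row_succ l := by
    have := h.fst.row_lt_row_succ l
    have := h.snd.row_lt_row_succ l
    have := h.row_lt_fillStart
    have := h.succ_le_fillStart
    have : fillStart c₂ m (p₁ m) ≤ c₂.row (m + 1) := min_le_left _ _
    dsimp only [Column.exchangeAboveSnd, upperMax]
    grind
  row_le := h.upperMax_le
  row_eq l hl := (if_neg (h.lt_level_of_immobile (hl.trans (h.dominates.le l))).not_ge).trans
    (h.snd.row_eq l hl)
  dead_bounds l i hi := by
    rcases hi with ⟨hlm, hi, hlt, hlt'⟩ | ⟨hml, hi⟩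
    · refine ⟨hlt, ?_, hlt'⟩
      rcases hi with hi | hi
      · have hi := (h.fst.dead_bounds l i hi).2.1
        obtain heq | hsucc := h.dominates.eq_or_consecutive l hlm.le
        · exact heq ▸ hi
        · have := hsucc l le_rfl hlm.le
          have := h.upperMax_le (l + 1)
          omega
      · exact (h.snd.dead_bounds l i hi).2.1
    · have := h.snd.dead_bounds l i hi
      dsimp only [Column.exchangeAboveSnd, upperMax]
      grind

theorem isAdmissible_exchangeAboveFst (h : Exchangeable p₁ p₂ n m c₁ c₂) :
    (exchangeAboveFst c₁ c₂ m (p₁ m)).IsAdmissible p₁ n where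
  row_lt_row_succ l := by
    have := h.fst.row_lt_row_succ l
    have := h.snd.row_lt_row_succ l
    dsimp only [Column.exchangeAboveFst, upperMin]
    grind
  row_le l := by
    have := h.fst.row_le l
    dsimp only [Column.exchangeAboveFst, upperMin]
    grind
  row_eq l hl := (if_neg (h.lt_level_of_immobile hl).not_ge).trans (h.fst.row_eq l hl)
  dead_bounds l i hi := by
    have := h.fst.dead_bounds l i
    have := h.snd.dead_bounds l i
    have := h.dominates.le l
    rcases hi with ⟨-, hi, hlt, hlt', -⟩ | ⟨rfl, hi⟩
    · exact ⟨hlt, by grind, hlt'⟩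
    · have := h.row_lt_fillStart
      have := h.lt_row
      dsimp only [Column.exchangeAboveFst, upperMin]
      grind

variable {l i : ℕ}

theorem level_le (h : Exchangeable p₁ p₂ n m c₁ c₂) (hi : i < fillStart c₂ m (p₁ m))
    (hl : c₁.At l i ∨ c₂.At l i) : l ≤ m := by
  refine Nat.lt_succ_iff.1 (hl.elim (fun hl => h.fst.level_lt hl ?_) fun hl => h.snd.level_lt hl ?_)
  · exact (Nat.lt_succ_iff.1 (hi.trans_le (min_le_right _ _))).trans_lt h.lt_row
  · exact hi.trans_le (min_le_left _ _)

theorem occupied_fst_of_fillStart_le (h : Exchangeable p₁ p₂ n m c₁ c₂)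
    (hi : fillStart c₂ m (p₁ m) ≤ i) (hocc : c₁.Occupied i) :
    (exchangeAboveFst c₁ c₂ m (p₁ m)).Occupied i := by
  obtain ⟨l, hl⟩ := hocc
  rcases le_or_gt i (p₁ m) with him | hmi
  · exact ⟨m, Or.inr (Or.inr ⟨rfl, Or.inr (Or.inr ⟨hi, him⟩)⟩)⟩
  · have hml : m < l :=
      h.strictMono.lt_iff_lt.1 (hmi.trans_le (h.fst.bounds_of_at hl).2.2)
    exact ⟨l, Or.inl ((if_neg hml.not_ge).trans (hl.resolve_right (h.not_dead l i hml)))⟩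

theorem occupied_snd_of_fillStart_le (h : Exchangeable p₁ p₂ n m c₁ c₂)
    (hi : fillStart c₂ m (p₁ m) ≤ i) (hocc : c₂.Occupied i) :
    (exchangeAboveSnd c₁ c₂ m (p₁ m)).Occupied i := by
  obtain ⟨l, hl⟩ := hocc
  have hml : m < l := by
    rcases min_le_iff.1 hi with hi | hi
    · exact h.snd.le_level hl hi
    · exact h.strictMono.lt_iff_lt.1
        (hi.trans ((h.snd.bounds_of_at hl).2.2.trans (h.dominates.le l)))
  exact ⟨l, hl.imp (fun hl => (if_neg hml.not_ge).trans hl) fun hl => Or.inr ⟨hml, hl⟩⟩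

theorem occupied_fst_of_min_eq (hl : l ≤ m) (hi : min (c₁.row l) (c₂.row l) = i) :
    (exchangeAboveFst c₁ c₂ m (p₁ m)).Occupied i :=
  ⟨l, Or.inl ((if_pos hl).trans hi)⟩

theorem occupied_fst_of_dead (h : Exchangeable p₁ p₂ n m c₁ c₂) (hl : l ≤ m)
    (hd : c₁.dead l i ∨ c₂.dead l i) (hi₁ : i < c₁.row (l + 1)) (hi₂ : i < c₂.row (l + 1))
    (hi : i ≤ max (c₁.row l) (c₂.row l)) :
    (exchangeAboveFst c₁ c₂ m (p₁ m)).Occupied i := by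
  obtain rfl | hlm := hl.eq_or_lt
  · exact ⟨l, Or.inr (Or.inr ⟨rfl, by tauto⟩)⟩
  have hmin : min (c₁.row l) (c₂.row l) < i := hd.elim
    (fun hd => (min_le_left _ _).trans_lt (h.fst.dead_bounds _ _ hd).1)
    (fun hd => (min_le_right _ _).trans_lt (h.snd.dead_bounds _ _ hd).1)
  refine ⟨l, Or.inr (Or.inl ⟨hlm, hd, ?_, ?_, ?_⟩)⟩
  · exact (if_pos hl).trans_lt hmin
  · exact (lt_min hi₁ hi₂).trans_eq (if_pos hlm).symm
  · rintro (⟨-, -, hlt, hlt'⟩ | ⟨hml, -⟩)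
    · have := h.succ_le_fillStart
      unfold upperMax at hlt hlt'
      grind
    · exact hml.not_gt hlm

theorem occupied_fst_of_at_of_lt (h : Exchangeable p₁ p₂ n m c₁ c₂) (hl : l ≤ m)
    (hi : c₁.At l i ∧ i < c₂.row l ∨ c₂.At l i ∧ i < c₁.row l) :
    (exchangeAboveFst c₁ c₂ m (p₁ m)).Occupied i := by
  have := h.fst.row_lt_row_succ l
  have := h.snd.row_lt_row_succ l
  rcases hi with ⟨rfl | hd, hlt⟩ | ⟨rfl | hd, hlt⟩
  · exact occupied_fst_of_min_eq hl (min_eq_left hlt.le)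
  · have := h.fst.dead_bounds _ _ hd
    exact h.occupied_fst_of_dead hl (Or.inl hd) (by omega) (by omega) (by omega)
  · exact occupied_fst_of_min_eq hl (min_eq_right hlt.le)
  · have := h.snd.dead_bounds _ _ hd
    exact h.occupied_fst_of_dead hl (Or.inr hd) (by omega) (by omega) (by omega)

theorem occupied_snd_of_cut_le (h : Exchangeable p₁ p₂ n m c₁ c₂)
    (hi : i < fillStart c₂ m (p₁ m)) (hcut : fillStart c₂ m (p₁ m) - (m + 1) + l ≤ i)
    (hmax : fillStart c₂ m (p₁ m) - (m + 1) + l ≤ max (c₁.row l) (c₂.row l)) :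
    (exchangeAboveSnd c₁ c₂ m (p₁ m)).Occupied i := by
  -- from level `l` to level `m` the cut is attained
  refine ⟨i - (fillStart c₂ m (p₁ m) - (m + 1)), Or.inl ((if_pos (by omega)).trans ?_)⟩
  have hle : l ≤ i - (fillStart c₂ m (p₁ m) - (m + 1)) := by omega
  have := add_sub_le_of_strictMono h.fst.strictMono hle
  have := add_sub_le_of_strictMono h.snd.strictMono hle
  omega

theorem occupied_snd_of_max_eq (h : Exchangeable p₁ p₂ n m c₁ c₂) (hl : l ≤ m)
    (hi : i < fillStart c₂ m (p₁ m)) (hmax : max (c₁.row l) (c₂.row l) = i) :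
    (exchangeAboveSnd c₁ c₂ m (p₁ m)).Occupied i := by
  rcases le_total (fillStart c₂ m (p₁ m) - (m + 1) + l) i with hcut | hcut
  · exact h.occupied_snd_of_cut_le hi hcut (hcut.trans_eq hmax.symm)
  · exact ⟨l, Or.inl ((if_pos hl).trans (by omega))⟩

theorem occupied_snd_of_at_of_lt (h : Exchangeable p₁ p₂ n m c₁ c₂) (hl : l < m)
    (hi : i < fillStart c₂ m (p₁ m)) (hat : c₁.At l i ∧ c₂.row l < i ∨ c₂.At l i ∧ c₁.row l < i) :
    (exchangeAboveSnd c₁ c₂ m (p₁ m)).Occupied i := by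
  have hd : c₁.dead l i ∧ c₂.row l < i ∨ c₂.dead l i ∧ c₁.row l < i ∨
      max (c₁.row l) (c₂.row l) = i := by
    grind [At]
  rw [← or_assoc] at hd
  rcases hd with hd | hmax
  · have hlt : max (c₁.row l) (c₂.row l) < i ∧ i < max (c₁.row (l + 1)) (c₂.row (l + 1)) := by
      have := h.fst.dead_bounds l i
      have := h.snd.dead_bounds l i
      grind
    rcases le_or_gt (fillStart c₂ m (p₁ m) - (m + 1) + (l + 1)) i with hcut | hcut
    · exact h.occupied_snd_of_cut_le hi hcut (hcut.trans hlt.2.le)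
    · exact ⟨l, Or.inr (Or.inl ⟨hl, hd.imp And.left And.left,
        (if_pos hl.le).trans_lt ((min_le_left _ _).trans_lt hlt.1),
        (lt_min hlt.2 hcut).trans_eq (if_pos hl).symm⟩)⟩
  · exact h.occupied_snd_of_max_eq hl.le hi hmax

theorem occupied_both (h : Exchangeable p₁ p₂ n m c₁ c₂) (hi : i < fillStart c₂ m (p₁ m))
    (hi₁ : c₁.Occupied i) (hi₂ : c₂.Occupied i) :
    (exchangeAboveFst c₁ c₂ m (p₁ m)).Occupied i ∧
      (exchangeAboveSnd c₁ c₂ m (p₁ m)).Occupied i := by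
  obtain ⟨l, hl⟩ := hi₁
  obtain ⟨k, hk⟩ := hi₂
  have hlm := h.level_le hi (Or.inl hl)
  have hkm := h.level_le hi (Or.inr hk)
  have hlb := h.fst.bounds_of_at hl
  have hkb := h.snd.bounds_of_at hk
  rcases lt_trichotomy l k with hlk | rfl | hkl
  · have := h.fst.strictMono.monotone (show l + 1 ≤ k from hlk)
    have := h.snd.strictMono hlk
    exact ⟨h.occupied_fst_of_at_of_lt hkm (Or.inr ⟨hk, by omega⟩),
      h.occupied_snd_of_at_of_lt (hlk.trans_le hkm) hi (Or.inl ⟨hl, by omega⟩)⟩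
  · have hlive : c₁.row l = i ∨ c₂.row l = i :=
      or_iff_not_and_not.2 fun hne =>
        h.disjoint l i (hl.resolve_left hne.1) (hk.resolve_left hne.2)
    refine ⟨?_, h.occupied_snd_of_max_eq hlm hi (by omega)⟩
    by_cases hmin : min (c₁.row l) (c₂.row l) = i
    · exact occupied_fst_of_min_eq hlm hmin
    · refine h.occupied_fst_of_dead hlm ?_ hlb.2.1 hkb.2.1 (by omega)
      grind [At]
  · have := h.snd.strictMono.monotone (show k + 1 ≤ l from hkl)
    have := h.fst.strictMono hkl
    exact ⟨h.occupied_fst_of_at_of_lt hlm (Or.inl ⟨hl, by omega⟩),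
      h.occupied_snd_of_at_of_lt (hkl.trans_le hlm) hi (Or.inr ⟨hk, by omega⟩)⟩

theorem occupied_either (h : Exchangeable p₁ p₂ n m c₁ c₂) (hi : i < fillStart c₂ m (p₁ m))
    (hl : c₁.At l i ∨ c₂.At l i) :
    (exchangeAboveFst c₁ c₂ m (p₁ m)).Occupied i ∨
      (exchangeAboveSnd c₁ c₂ m (p₁ m)).Occupied i := by
  have hlm := h.level_le hi hl
  by_cases hmax : max (c₁.row l) (c₂.row l) = i
  · exact Or.inr (h.occupied_snd_of_max_eq hlm hi hmax)
  have hlb := h.fst.bounds_of_at (l := l) (i := i)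
  have hkb := h.snd.bounds_of_at (l := l) (i := i)
  by_cases hlt : c₁.At l i ∧ i < c₂.row l ∨ c₂.At l i ∧ i < c₁.row l
  · exact Or.inl (h.occupied_fst_of_at_of_lt hlm hlt)
  have hat : c₁.At l i ∧ c₂.row l < i ∨ c₂.At l i ∧ c₁.row l < i := by grind
  obtain rfl | hlm := hlm.eq_or_lt
  · refine Or.inl ⟨l, Or.inr (Or.inr ⟨rfl, ?_⟩)⟩
    grind [At]
  · exact Or.inr (h.occupied_snd_of_at_of_lt hlm hi hat)

theorem pairLE (h : Exchangeable p₁ p₂ n m c₁ c₂) :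
    PairLE c₁ c₂ (exchangeAboveFst c₁ c₂ m (p₁ m))
      (exchangeAboveSnd c₁ c₂ m (p₁ m)) where
  both i hi₁ hi₂ := (lt_or_ge i (fillStart c₂ m (p₁ m))).elim
    (fun hi => h.occupied_both hi hi₁ hi₂) fun hi =>
      ⟨h.occupied_fst_of_fillStart_le hi hi₁, h.occupied_snd_of_fillStart_le hi hi₂⟩
  either i hocc := (lt_or_ge i (fillStart c₂ m (p₁ m))).elim
    (fun hi => hocc.elim (fun ⟨_, hl⟩ => h.occupied_either hi (Or.inl hl))
      fun ⟨_, hl⟩ => h.occupied_either hi (Or.inr hl)) fun hi =>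
      hocc.imp (h.occupied_fst_of_fillStart_le hi) (h.occupied_snd_of_fillStart_le hi)

end Exchangeable

end ExchangeAbove

/-- The live squares up to level `m` move to the top, and all rows down to row `b` are filled with
dead squares of level `m`. -/
def fill (c : Column) (m b : ℕ) : Column where
  row l := if l ≤ m then l else c.row l
  dead l i := l = m ∧ m < i ∧ i ≤ b

/-- The dead squares of level at most `m` are those of level `m` in the rows after row `m` down to
row `b`. For an admissible column that starts at row `b` in level `m` there can be no more of level
`m`, and all rows down to row `b` are then occupied. -/
structure IsFull (c : Column) (m b : ℕ) : Prop where
  not_dead : ∀ l i, l < m → ¬ c.dead l i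
  dead_iff : ∀ i, c.dead m i ↔ m < i ∧ i ≤ b

theorem isFull_fill (c : Column) (m b : ℕ) : (c.fill m b).IsFull m b where
  not_dead _ _ hl hd := hl.ne hd.1
  dead_iff _ := and_iff_right rfl

theorem IsAdmissible.fill (h : c.IsAdmissible p n) (hp : StrictMono p) (hn : p m < n)
    (hm : p m < c.row (m + 1)) : (c.fill m (p m)).IsAdmissible p n := by
  constructor <;> intro l <;> dsimp only [Column.fill]
  · grind [h.row_lt_row_succ l, h.self_le_row (l + 1)]
  · grind [h.self_le_row l, h.row_le l]
  · intro hl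
    have hml : m < l := hp.lt_iff_lt.1 (hn.trans_le hl)
    exact (if_neg hml.not_ge).trans (h.row_eq l hl)
  · grind

theorem IsAdmissible.occupied_fill (h : c.IsAdmissible p n) (hp : StrictMono p)
    (hd : ∀ l i, m < l → ¬ c.dead l i) {i : ℕ} (hi : c.Occupied i) :
    (c.fill m (p m)).Occupied i := by
  obtain ⟨l, hl⟩ := hi
  rcases le_or_gt i (p m) with him | hmi
  · rcases le_or_gt i m with him' | hmi'
    · exact ⟨i, Or.inl (if_pos him')⟩
    · exact ⟨m, Or.inr ⟨rfl, hmi', him⟩⟩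
  · have hml : m < l := hp.lt_iff_lt.1 (hmi.trans_le (h.bounds_of_at hl).2.2)
    exact ⟨l, Or.inl ((if_neg hml.not_ge).trans (hl.resolve_right (hd l i hml)))⟩

end Column

section Configuration

variable {ι : Type*} {p : ι → ℕ → ℕ} {n : ℕ} {C : ι → Column}

/-- A family of admissible columns in which no two columns have dead squares of the same level in
the same row. It encodes a bubbling diagram by `BubblingDiagram.Represents`. -/
structure IsConfiguration (p : ι → ℕ → ℕ) (n : ℕ) (C : ι → Column) : Prop where
  isAdmissible : ∀ j, (C j).IsAdmissible (p j) n
  dead_unique : ∀ j k l i, (C j).dead l i → (C k).dead l i → j = k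

/-- The number of squares, live or dead, in row `i`. -/
noncomputable def occupiedCount (C : ι → Column) (i : ℕ) : ℕ := {j | (C j).Occupied i}.ncard

/-- No column choice in `B` concerns the column `k`. -/
def IsFree (B : List (ι × ℕ)) (k : ι) : Prop := ∀ b ∈ B, b.1 ≠ k

/-- The choice of level `m` in column `j` is a greedy one after the choices in `B`. These are the
properties of the distinguished squares that make it possible to fill the columns one by one. -/
structure IsGreedyStep (p : ι → ℕ → ℕ) (n : ℕ) (B : List (ι × ℕ)) (j : ι) (m : ℕ) : Prop where
  lt : p j m < n
  isFree : IsFree B j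
  dominates : ∀ k, k ≠ j → IsFree B k → p k m < n → Column.Dominates (p j) (p k) m
  blocked : ∀ l, m < l → p j l < n → ∀ k, IsFree B k → p k l < n →
    ∃ b ∈ B, b.2 = l ∧ p k l ≤ p b.1 l
  lt_of_mem : ∀ b ∈ B, m < b.2 ∨ n ≤ p b.1 m

/-- `C'` is a configuration with at least as many squares as `C` in each row, in which all columns
chosen in `B` are full. -/
structure IsImprovement (p : ι → ℕ → ℕ) (n : ℕ) (B : List (ι × ℕ)) (C C' : ι → Column) :
    Prop where
  isConfiguration : IsConfiguration p n C'
  isFull : ∀ b ∈ B, (C' b.1).IsFull b.2 (p b.1 b.2)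
  occupiedCount_le : ∀ i, occupiedCount C i ≤ occupiedCount C' i

theorem IsImprovement.trans {B B' : List (ι × ℕ)} {C' C'' : ι → Column}
    (h : IsImprovement p n B C C') (h' : IsImprovement p n B' C' C'') :
    IsImprovement p n B' C C'' :=
  ⟨h'.isConfiguration, h'.isFull, fun i => (h.occupiedCount_le i).trans (h'.occupiedCount_le i)⟩

theorem occupiedCount_le_of_perm [Finite ι] {C' : ι → Column} {i : ℕ} (σ : Equiv.Perm ι)
    (h : ∀ x, (C x).Occupied i → (C' (σ x)).Occupied i) :
    occupiedCount C i ≤ occupiedCount C' i :=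
  Set.ncard_le_ncard_of_injOn σ (fun x hx => h x hx) σ.injective.injOn

section Update

variable [DecidableEq ι] {j k : ι} {c c₁ c₂ : Column}

theorem IsConfiguration.update (h : IsConfiguration p n C) (hc : c.IsAdmissible (p j) n)
    (hd : ∀ l i, c.dead l i → ∀ x, x ≠ j → ¬ (C x).dead l i) :
    IsConfiguration p n (Function.update C j c) where
  isAdmissible x := by
    rcases eq_or_ne x j with rfl | hx
    · rwa [Function.update_self]
    · rw [Function.update_of_ne hx]
      exact h.isAdmissible x
  dead_unique x y l i hx hy := by
    have := hd l i
    have := h.dead_unique x y l i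
    grind [Function.update_apply]

theorem IsConfiguration.update_update (h : IsConfiguration p n C)
    (hc₁ : c₁.IsAdmissible (p j) n) (hc₂ : c₂.IsAdmissible (p k) n)
    (hd : ∀ l i, c₁.dead l i → ¬ c₂.dead l i)
    (hd' : ∀ l i, c₁.dead l i ∨ c₂.dead l i → ∀ x, x ≠ j → x ≠ k → ¬ (C x).dead l i) :
    IsConfiguration p n (Function.update (Function.update C j c₁) k c₂) where
  isAdmissible x := by
    rcases eq_or_ne x k with rfl | hxk
    · rwa [Function.update_self]
    rw [Function.update_of_ne hxk]
    rcases eq_or_ne x j with rfl | hxj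
    · rwa [Function.update_self]
    · rw [Function.update_of_ne hxj]
      exact h.isAdmissible x
  dead_unique x y l i hx hy := by
    have := hd l i
    have := hd' l i
    have := h.dead_unique x y l i
    grind [Function.update_apply]

theorem occupiedCount_le_update [Finite ι] {i : ℕ} (h : (C j).Occupied i → c.Occupied i) :
    occupiedCount C i ≤ occupiedCount (Function.update C j c) i := by
  refine occupiedCount_le_of_perm 1 fun x hx => ?_
  grind [Function.update_apply, Equiv.Perm.one_apply]

theorem occupiedCount_le_update_update [Finite ι] (hkj : k ≠ j)
    (h : Column.PairLE (C j) (C k) c₁ c₂) (i : ℕ) :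
    occupiedCount C i ≤ occupiedCount (Function.update (Function.update C j c₁) k c₂) i := by
  have hboth := h.both i
  have heither := h.either i
  by_cases hid : ((C j).Occupied i → c₁.Occupied i) ∧ ((C k).Occupied i → c₂.Occupied i)
  · refine occupiedCount_le_of_perm 1 fun x hx => ?_
    grind [Function.update_apply, Equiv.Perm.one_apply]
  · refine occupiedCount_le_of_perm (Equiv.swap j k) fun x hx => ?_
    grind [Function.update_apply]

theorem IsConfiguration.isImprovement_update [Finite ι] {B : List (ι × ℕ)}
    (h : IsConfiguration p n C) (hB : ∀ b ∈ B, (C b.1).IsFull b.2 (p b.1 b.2)) (hj : IsFree B j)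
    (hc : c.IsAdmissible (p j) n) (hd : ∀ l i, c.dead l i → ∀ x, x ≠ j → ¬ (C x).dead l i)
    (hocc : ∀ i, (C j).Occupied i → c.Occupied i) :
    IsImprovement p n B C (Function.update C j c) where
  isConfiguration := h.update hc hd
  isFull b hb := by
    rw [Function.update_of_ne (hj b hb)]
    exact hB b hb
  occupiedCount_le i := occupiedCount_le_update (hocc i)

theorem IsConfiguration.isImprovement_update_update [Finite ι] {B : List (ι × ℕ)}
    (h : IsConfiguration p n C) (hB : ∀ b ∈ B, (C b.1).IsFull b.2 (p b.1 b.2)) (hj : IsFree B j)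
    (hk : IsFree B k) (hkj : k ≠ j) (hc₁ : c₁.IsAdmissible (p j) n)
    (hc₂ : c₂.IsAdmissible (p k) n) (hd : ∀ l i, c₁.dead l i → ¬ c₂.dead l i)
    (hd' : ∀ l i, c₁.dead l i ∨ c₂.dead l i → ∀ x, x ≠ j → x ≠ k → ¬ (C x).dead l i)
    (hpair : Column.PairLE (C j) (C k) c₁ c₂) :
    IsImprovement p n B C (Function.update (Function.update C j c₁) k c₂) where
  isConfiguration := h.update_update hc₁ hc₂ hd hd'
  isFull b hb := by
    rw [Function.update_of_ne (hk b hb), Function.update_of_ne (hj b hb)]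
    exact hB b hb
  occupiedCount_le := occupiedCount_le_update_update hkj hpair

end Update

section GreedyStep

variable {B : List (ι × ℕ)} {j k : ι} {m : ℕ}

namespace IsGreedyStep

theorem not_dead (hg : IsGreedyStep p n B j m) (h : IsConfiguration p n C)
    (hB : ∀ b ∈ B, (C b.1).IsFull b.2 (p b.1 b.2)) (hk : IsFree B k) {l : ℕ} (hl : m < l)
    (hpl : p j l < n) (i : ℕ) : ¬ (C k).dead l i := by
  intro hd
  obtain ⟨b, hb, rfl, hle⟩ := hg.blocked l hl hpl k hk ((h.isAdmissible k).lt_of_dead hd)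
  have hbd := (h.isAdmissible k).dead_bounds _ _ hd
  have hfull : (C b.1).dead b.2 i :=
    ((hB b hb).dead_iff i).2
      ⟨((h.isAdmissible k).self_le_row _).trans_lt hbd.1, hbd.2.1.trans hle⟩
  exact hk b hb (h.dead_unique _ _ _ _ hfull hd)

theorem not_dead_self (hg : IsGreedyStep p n B j m) (h : IsConfiguration p n C)
    (hB : ∀ b ∈ B, (C b.1).IsFull b.2 (p b.1 b.2)) (l i : ℕ) (hl : m < l) : ¬ (C j).dead l i :=
  fun hd => hg.not_dead h hB hg.isFree hl ((h.isAdmissible j).lt_of_dead hd) i hd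

theorem isFree_of_dead (hg : IsGreedyStep p n B j m) (h : IsConfiguration p n C)
    (hB : ∀ b ∈ B, (C b.1).IsFull b.2 (p b.1 b.2)) {i : ℕ} (hd : (C k).dead m i) : IsFree B k := by
  rintro b hb rfl
  obtain hlt | hle := hg.lt_of_mem b hb
  · exact (hB b hb).not_dead _ _ hlt hd
  · exact hle.not_gt ((h.isAdmissible b.1).lt_of_dead hd)

theorem dominates_of_dead (hg : IsGreedyStep p n B j m) (h : IsConfiguration p n C)
    (hB : ∀ b ∈ B, (C b.1).IsFull b.2 (p b.1 b.2)) (hkj : k ≠ j) {i : ℕ}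
    (hd : (C k).dead m i) : Column.Dominates (p j) (p k) m :=
  hg.dominates k hkj (hg.isFree_of_dead h hB hd) ((h.isAdmissible k).lt_of_dead hd)

variable [Finite ι]

theorem exists_improvement_push (hg : IsGreedyStep p n B j m) (h : IsConfiguration p n C)
    (hB : ∀ b ∈ B, (C b.1).IsFull b.2 (p b.1 b.2)) (hp : StrictMono (p j))
    (hle : (C j).row (m + 1) ≤ p j m) (hd : ∀ k, ¬ (C k).dead m ((C j).row (m + 1))) :
    ∃ C', IsImprovement p n B C C' ∧ (C j).dead m < (C' j).dead m := by
  classical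
  refine ⟨_, h.isImprovement_update hB hg.isFree
    ((h.isAdmissible j).push hp hle (hg.not_dead_self h hB)) ?_
    fun _ => (h.isAdmissible j).occupied_push, ?_⟩
  · rintro l i (hdj | ⟨rfl, rfl⟩) x hx hdx
    · exact hx (h.dead_unique _ _ _ _ hdx hdj)
    · exact hd x hdx
  · rw [Function.update_self]
    exact lt_of_le_not_ge (fun i hi => Or.inl hi) fun hge => hd j (hge _ (Or.inr ⟨rfl, rfl⟩))

theorem exists_improvement_exchangeBelow (hg : IsGreedyStep p n B j m)
    (h : IsConfiguration p n C) (hB : ∀ b ∈ B, (C b.1).IsFull b.2 (p b.1 b.2))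
    (hd : (C k).dead m ((C j).row (m + 1))) :
    ∃ C', IsImprovement p n B C C' ∧ (C j).dead m < (C' j).dead m := by
  classical
  have hj := h.isAdmissible j
  have hk := h.isAdmissible k
  have hkj : k ≠ j := fun hkj => hj.not_dead_row (hkj ▸ hd)
  have hkB := hg.isFree_of_dead h hB hd
  have hle := (hg.dominates_of_dead h hB hkj hd).le
  have hdj := hg.not_dead_self h hB
  have hdk : ∀ l i, m < l → p j l < n → ¬ (C k).dead l i := fun l i hl hpl =>
    hg.not_dead h hB hkB hl hpl i
  refine ⟨_, h.isImprovement_update_update hB hg.isFree hkB hkj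
    (hj.exchangeBelowFst hk hle hdj) (hj.exchangeBelowSnd hk hle hdk hd) ?_ ?_
    (hj.pairLE_exchangeBelow hk hdj hdk hd), ?_⟩
  · rintro l i (hi | ⟨rfl, -, hi⟩) ⟨hi', hne⟩
    · exact hkj (h.dead_unique _ _ _ _ hi' hi)
    · exact hne ⟨rfl, hi⟩
  · rintro l i ((hi | ⟨rfl, hi, -⟩) | ⟨hi, -⟩) x hxj hxk hx
    · exact hxj (h.dead_unique _ _ _ _ hx hi)
    · exact hxk (h.dead_unique _ _ _ _ hx hi)
    · exact hxk (h.dead_unique _ _ _ _ hx hi)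
  · rw [Function.update_of_ne hkj.symm, Function.update_self]
    exact lt_of_le_not_ge (fun i hi => Or.inl hi)
      fun hge => hj.not_dead_row (hge _ (Or.inr ⟨rfl, hd, le_rfl⟩))

theorem exists_improvement_exchangeAbove (hg : IsGreedyStep p n B j m)
    (h : IsConfiguration p n C) (hB : ∀ b ∈ B, (C b.1).IsFull b.2 (p b.1 b.2))
    (hp : StrictMono (p j)) (hlt : p j m < (C j).row (m + 1))
    (hd : ∃ k i, k ≠ j ∧ (C k).dead m i) :
    ∃ C', IsImprovement p n B C C' ∧ (C j).dead m < (C' j).dead m := by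
  classical
  -- the new dead squares must not collide with the dead squares of a third column
  obtain ⟨k, ⟨hkj, i₀, hk₀⟩, hmax⟩ :=
    (Set.toFinite {k | k ≠ j ∧ ∃ i, (C k).dead m i}).exists_maximalFor
      (fun k => (C k).fillStart m (p j m)) _
      (let ⟨k, i, hkj, hk⟩ := hd; ⟨k, hkj, i, hk⟩)
  have hkB := hg.isFree_of_dead h hB hk₀
  have hex : Column.Exchangeable (p j) (p k) n m (C j) (C k) :=
    { fst := h.isAdmissible j
      snd := h.isAdmissible k
      strictMono := hp
      dominates := hg.dominates_of_dead h hB hkj hk₀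
      lt := hg.lt
      lt_row := hlt
      not_dead := hg.not_dead_self h hB
      disjoint := fun l i hi hi' => hkj (h.dead_unique _ _ _ _ hi' hi) }
  refine ⟨_, h.isImprovement_update_update hB hg.isFree hkB hkj hex.isAdmissible_exchangeAboveFst
    hex.isAdmissible_exchangeAboveSnd
    (fun l i => Column.not_dead_exchangeAboveSnd_of_dead_exchangeAboveFst) ?_ hex.pairLE, ?_⟩
  · intro l i hi x hxj hxk hx
    have hxd := (h.isAdmissible x).dead_bounds _ _ hx
    have hi' : (C j).dead l i ∨ (C k).dead l i ∨ l = m ∧ (C k).fillStart m (p j m) ≤ i := by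
      grind [Column.exchangeAboveFst, Column.exchangeAboveSnd]
    obtain hi | hi | ⟨rfl, hi⟩ := hi'
    · exact hxj (h.dead_unique _ _ _ _ hx hi)
    · exact hxk (h.dead_unique _ _ _ _ hx hi)
    · have := hmax ⟨hxj, i, hx⟩
      have := (hg.dominates_of_dead h hB hxj hx).le l
      have : i < (C x).fillStart l (p j l) := lt_min hxd.2.2 (by omega)
      dsimp only at *
      omega
  · rw [Function.update_of_ne hkj.symm, Function.update_self]
    exact lt_of_le_not_ge (fun i hi => Or.inr ⟨rfl, Or.inl hi⟩) fun hge =>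
      hkj (h.dead_unique _ _ _ _ hk₀ (hge _ (Or.inr ⟨rfl, Or.inr (Or.inl hk₀)⟩)))

theorem exists_improvement_fill (hg : IsGreedyStep p n B j m) (h : IsConfiguration p n C)
    (hB : ∀ b ∈ B, (C b.1).IsFull b.2 (p b.1 b.2)) (hp : StrictMono (p j))
    (hlt : p j m < (C j).row (m + 1)) (hd : ∀ k i, k ≠ j → ¬ (C k).dead m i) :
    ∃ C', IsImprovement p n B C C' ∧ (C' j).IsFull m (p j m) := by
  classical
  refine ⟨_, h.isImprovement_update hB hg.isFree ((h.isAdmissible j).fill hp hg.lt hlt) ?_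
    fun i => (h.isAdmissible j).occupied_fill hp (hg.not_dead_self h hB), ?_⟩
  · rintro l i ⟨rfl, -⟩ x hx
    exact hd x i hx
  · rw [Function.update_self]
    exact (C j).isFull_fill m (p j m)

theorem exists_improvement_isFull (hg : IsGreedyStep p n B j m) (hp : StrictMono (p j))
    (C : ι → Column) (h : IsConfiguration p n C)
    (hB : ∀ b ∈ B, (C b.1).IsFull b.2 (p b.1 b.2)) :
    ∃ C', IsImprovement p n B C C' ∧ (C' j).IsFull m (p j m) := by
  have hfin : ∀ C, IsConfiguration p n C → {i | (C j).dead m i} ⊆ Set.Iio n := fun C h i hi =>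
    ((h.isAdmissible j).dead_bounds _ _ hi).2.1.trans_lt hg.lt
  induction hN : n - {i | (C j).dead m i}.ncard using Nat.strong_induction_on generalizing C with
  | _ N ih =>
  suffices hstep : (∃ C', IsImprovement p n B C C' ∧ (C j).dead m < (C' j).dead m) ∨
      ∃ C', IsImprovement p n B C C' ∧ (C' j).IsFull m (p j m) by
    obtain ⟨C', hC', hlt⟩ | hfull := hstep
    · have hcard := Set.ncard_lt_ncard (s := {i | (C j).dead m i}) (t := {i | (C' j).dead m i}) hlt
        ((Set.finite_Iio n).subset (hfin C' hC'.isConfiguration))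
      have hle := Set.ncard_le_ncard (hfin C' hC'.isConfiguration) (Set.finite_Iio n)
      rw [Set.ncard_Iio_nat] at hle
      obtain ⟨C'', hC'', hfull⟩ := ih _ (by omega) C' hC'.isConfiguration hC'.isFull rfl
      exact ⟨C'', hC'.trans hC'', hfull⟩
    · exact hfull
  rcases le_or_gt ((C j).row (m + 1)) (p j m) with hle | hlt
  · by_cases hk : ∃ k, (C k).dead m ((C j).row (m + 1))
    · obtain ⟨k, hk⟩ := hk
      exact Or.inl (hg.exists_improvement_exchangeBelow h hB hk)
    · exact Or.inl (hg.exists_improvement_push h hB hp hle (not_exists.1 hk))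
  · by_cases hk : ∃ k i, k ≠ j ∧ (C k).dead m i
    · exact Or.inl (hg.exists_improvement_exchangeAbove h hB hp hlt hk)
    · push Not at hk
      exact Or.inr (hg.exists_improvement_fill h hB hp hlt hk)

end IsGreedyStep

theorem IsConfiguration.exists_isImprovement [Finite ι] (h : IsConfiguration p n C)
    (hp : ∀ j, StrictMono (p j)) (A : List (ι × ℕ))
    (hA : ∀ B j m R, A = B ++ (j, m) :: R → IsGreedyStep p n B j m) :
    ∃ C', IsImprovement p n A C C' := by
  induction A using List.reverseRecOn with
  | nil => exact ⟨C, h, by simp, fun _ => le_rfl⟩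
  | append_singleton A a ih =>
    obtain ⟨C', hC'⟩ := ih fun B j m R hBR => hA B j m (R ++ [a]) (by simp [hBR])
    obtain ⟨C'', hC'', hfull⟩ := (hA A a.1 a.2 [] rfl).exists_improvement_isFull (hp a.1) C'
      hC'.isConfiguration hC'.isFull
    have hC := hC'.trans hC''
    refine ⟨C'', hC.isConfiguration, fun b hb => ?_, hC.occupiedCount_le⟩
    obtain hb | hb := List.mem_append.1 hb
    · exact hC.isFull b hb
    · rwa [List.mem_singleton.1 hb]

end GreedyStep

end Configuration

theorem nth_le_nth_of_imp {p q : ℕ → Prop} (hp : (Set.ofPred p).Infinite) {l : ℕ}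
    (h : ∀ i ≤ Nat.nth p l, p i → q i) : Nat.nth q l ≤ Nat.nth p l := by
  classical
  refine Nat.lt_succ_iff.1 (Nat.nth_lt_of_lt_count ?_)
  calc l < Nat.count p (Nat.nth p l + 1) := by
        rw [Nat.count_succ, Nat.count_nth_of_infinite hp, if_pos (Nat.nth_mem_of_infinite hp l)]
        exact l.lt_succ_self
    _ ≤ Nat.count q (Nat.nth p l + 1) :=
        Nat.count_mono_left fun i hi => h i (Nat.lt_succ_iff.1 hi)

theorem nth_succ_le {p : ℕ → Prop} {l i : ℕ} (h : Nat.nth p l < i) (hi : p i) :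
    Nat.nth p (l + 1) ≤ i := by
  by_contra! hc
  exact (Nat.le_nth_of_lt_nth_succ hc hi).not_gt h

section RotheDiagram

variable {n : ℕ} (w : Equiv.Perm (Fin n))

/-- The rows of the squares of `D(w)` in column `j`, continued by all rows below the grid. -/
def ColumnRow (j : Fin n) (i : ℕ) : Prop :=
  n ≤ i ∨ ∃ h : i < n, ((⟨i, h⟩, j) : Square n n) ∈ rotheDiagram w

/-- The row of the square of level `l` of `D(w)` in column `j`; the levels in a column are counted
from the top, starting at `0`. -/
noncomputable def levelRow (j : Fin n) (l : ℕ) : ℕ := Nat.nth (ColumnRow w j) l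

open Classical in
/-- The level of a square of `D(w)`: the number of squares above it in its column. -/
noncomputable def level (x : Square n n) : ℕ := Nat.count (ColumnRow w x.2) x.1

/-- Every row with a square of `D(w)` in column `j` has one in column `k`. -/
def ColumnSubset (j k : Fin n) : Prop := ∀ i, (i, j) ∈ rotheDiagram w → (i, k) ∈ rotheDiagram w

theorem infinite_columnRow (j : Fin n) : (Set.ofPred (ColumnRow w j)).Infinite :=
  (Set.Ici_infinite n).mono fun _ hi => Or.inl hi

theorem strictMono_levelRow (j : Fin n) : StrictMono (levelRow w j) :=
  Nat.nth_strictMono (infinite_columnRow w j)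

variable {w}

theorem mem_rotheDiagram {x : Square n n} :
    x ∈ rotheDiagram w ↔ x.1 < w.symm x.2 ∧ x.2 < w x.1 := by
  simp [rotheDiagram]

theorem columnRow_iff {i j : Fin n} : ColumnRow w j i ↔ (i, j) ∈ rotheDiagram w := by
  simp [ColumnRow, i.2.not_ge]

theorem mem_rotheDiagram_levelRow {j : Fin n} {l : ℕ} (h : levelRow w j l < n) :
    ((⟨levelRow w j l, h⟩, j) : Square n n) ∈ rotheDiagram w :=
  columnRow_iff.1 (Nat.nth_mem_of_infinite (infinite_columnRow w j) l)

theorem levelRow_level {x : Square n n} (hx : x ∈ rotheDiagram w) :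
    levelRow w x.2 (level w x) = x.1 := by
  classical
  exact Nat.nth_count (columnRow_iff.2 hx)

theorem level_levelRow {j : Fin n} {l : ℕ} (h : levelRow w j l < n) :
    level w (⟨levelRow w j l, h⟩, j) = l :=
  (strictMono_levelRow w j).injective (levelRow_level (mem_rotheDiagram_levelRow h))

theorem level_eq_card {x : Square n n} (hx : x ∈ rotheDiagram w) :
    level w x = ((Finset.Iio x.1).filter fun k => ¬ w k < x.2).card := by
  classical
  obtain ⟨hx₁, -⟩ := mem_rotheDiagram.1 hx
  have hrow : ∀ k < x.1, ColumnRow w x.2 k ↔ ¬ w k < x.2 := by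
    intro k hk
    have hne : x.2 ≠ w k := fun he => (hk.trans hx₁).ne' (w.symm_apply_eq.2 he)
    rw [columnRow_iff, mem_rotheDiagram, and_iff_right (hk.trans hx₁), not_lt, hne.le_iff_lt]
  rw [level, Nat.count_eq_card_filter_range, ← Nat.Iio_eq_range, ← Fin.map_valEmbedding_Iio,
    Finset.filter_map, Finset.card_map]
  exact congrArg _ (Finset.filter_congr fun k hk => hrow k (Finset.mem_Iio.1 hk))

theorem rotheRank_add_level {x : Square n n} (hx : x ∈ rotheDiagram w) :
    rotheRank w x + level w x = x.1 := by
  have hrank : rotheRank w x = ((Finset.Iio x.1).filter fun k => w k < x.2).card := by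
    rw [rotheRank, ← Finset.filter_filter, Finset.filter_gt_eq_Iio]
  rw [hrank, level_eq_card hx, Finset.card_filter_add_card_filter_not, Fin.card_Iio]

theorem rotheLinked_iff {x y : Square n n} (hx : x ∈ rotheDiagram w) (hy : y ∈ rotheDiagram w) :
    RotheLinked w x y ↔ level w x = level w y := by
  have := rotheRank_add_level hx
  have := rotheRank_add_level hy
  rw [RotheLinked]
  omega

theorem Vexillary.columnSubset_total (hw : Vexillary w) (j k : Fin n) :
    ColumnSubset w j k ∨ ColumnSubset w k j := by
  unfold ColumnSubset
  by_contra! hc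
  obtain ⟨⟨a, ha, ha'⟩, ⟨b, hb, hb'⟩⟩ := hc
  wlog hjk : j < k generalizing j k a b
  · rcases lt_or_eq_of_le (not_lt.1 hjk) with h | rfl
    · exact this k j b hb hb' a ha ha' h
    · exact ha' ha
  simp only [mem_rotheDiagram, not_and_or, not_lt] at ha ha' hb hb'
  have hjb : w.symm j < b :=
    (hb'.resolve_right (hjk.trans hb.2).not_ge).lt_of_ne fun he =>
      (hjk.trans hb.2).ne (w.symm_apply_eq.1 he)
  have hak : a < w.symm k := ha.1.trans (hjb.trans hb.1)
  have hwa : w a < k :=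
    (ha'.resolve_left hak.not_ge).lt_of_ne fun he => hak.ne (w.eq_symm_apply.2 he)
  exact hw a (w.symm j) b (w.symm k) ha.1 hjb hb.1 (by simpa using ⟨ha.2, hwa, hb.2⟩)

theorem Vexillary.mem_rotheDiagram_of_lt_of_lt (hw : Vexillary w) {j k a b r : Fin n}
    (hjk : ColumnSubset w j k) (ha : (a, k) ∈ rotheDiagram w) (ha' : (a, j) ∉ rotheDiagram w)
    (hb : (b, j) ∈ rotheDiagram w) (har : a < r) (hrb : r < b) : (r, k) ∈ rotheDiagram w := by
  by_contra hr
  obtain ⟨hbk, -⟩ := mem_rotheDiagram.1 (hjk b hb)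
  obtain ⟨-, hak⟩ := mem_rotheDiagram.1 ha
  simp only [mem_rotheDiagram, not_and_or, not_lt] at hr
  have hrk : w r ≤ k := hr.resolve_left (hrb.trans hbk).not_ge
  have har' : (a, w r) ∈ rotheDiagram w := by
    simpa [mem_rotheDiagram] using ⟨har, hrk.trans_lt hak⟩
  have hbr' : (b, w r) ∉ rotheDiagram w := by
    simpa [mem_rotheDiagram] using fun h => absurd h hrb.not_gt
  rcases hw.columnSubset_total j (w r) with h | h
  · exact hbr' (h b hb)
  · exact ha' (h a har')

theorem ColumnSubset.columnRow {j k : Fin n} (h : ColumnSubset w j k) {i : ℕ}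
    (hi : ColumnRow w j i) : ColumnRow w k i :=
  hi.imp_right fun ⟨hin, hij⟩ => ⟨hin, h _ hij⟩

theorem ColumnSubset.levelRow_le {j k : Fin n} (h : ColumnSubset w j k) (l : ℕ) :
    levelRow w k l ≤ levelRow w j l :=
  nth_le_nth_of_imp (infinite_columnRow w j) fun _ _ => h.columnRow

section Dominates

variable {j k : Fin n} {l m r : ℕ}

theorem Vexillary.columnRow_of_lt_of_le (hw : Vexillary w) (hjk : ColumnSubset w j k)
    (hm : levelRow w j m < n) (hl : levelRow w k l < levelRow w j l)
    (hlr : levelRow w k l < r) (hrm : r ≤ levelRow w j m) : ColumnRow w k r := by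
  obtain ⟨a, hal, hak, haj⟩ : ∃ a ≤ levelRow w k l, ColumnRow w k a ∧ ¬ ColumnRow w j a := by
    by_contra! hc
    exact (nth_le_nth_of_imp (infinite_columnRow w k) hc).not_gt hl
  obtain rfl | hrm := hrm.eq_or_lt
  · exact hjk.columnRow (Nat.nth_mem_of_infinite (infinite_columnRow w j) m)
  have har : a < r := hal.trans_lt hlr
  lift r to Fin n using hrm.trans hm
  lift a to Fin n using har.trans r.2
  rw [columnRow_iff] at hak haj ⊢
  exact hw.mem_rotheDiagram_of_lt_of_lt hjk hak haj (mem_rotheDiagram_levelRow hm) har hrm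

theorem Vexillary.levelRow_succ_eq (hw : Vexillary w) (hjk : ColumnSubset w j k)
    (hm : levelRow w j m < n) (hl : levelRow w k l < levelRow w j l) (hlr : l ≤ r)
    (hr : levelRow w k r < levelRow w j m) : levelRow w k (r + 1) = levelRow w k r + 1 := by
  have hrow : ColumnRow w k (levelRow w k r + 1) :=
    hw.columnRow_of_lt_of_le hjk hm hl
      (((strictMono_levelRow w k).monotone hlr).trans_lt (Nat.lt_succ_self _)) hr
  exact (nth_succ_le (Nat.lt_succ_self _) hrow).antisymm (strictMono_levelRow w k r.lt_succ_self)

theorem Vexillary.levelRow_lt_levelRow (hw : Vexillary w) (hjk : ColumnSubset w j k)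
    (hm : levelRow w j m < n) (hl : levelRow w k l < levelRow w j l) (hlr : l ≤ r) (hrm : r ≤ m) :
    levelRow w k r < levelRow w j r := by
  induction r, hlr using Nat.le_induction with
  | base => exact hl
  | succ r hlr ih =>
    have hr := ih (r.le_succ.trans hrm)
    have hj := strictMono_levelRow w j r.lt_succ_self
    rw [hw.levelRow_succ_eq hjk hm hl hlr
      (hr.trans_le ((strictMono_levelRow w j).monotone (r.le_succ.trans hrm)))]
    exact (Nat.succ_le_of_lt hr).trans_lt hj

theorem Vexillary.dominates (hw : Vexillary w) (hjk : ColumnSubset w j k)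
    (hm : levelRow w j m < n) : Column.Dominates (levelRow w j) (levelRow w k) m where
  le := hjk.levelRow_le
  eq_or_consecutive l _ := by
    refine (hjk.levelRow_le l).eq_or_lt.imp_right fun hl r hlr hrm => ?_
    exact hw.levelRow_succ_eq hjk hm hl hlr ((hw.levelRow_lt_levelRow hjk hm hl hlr hrm).trans_le
      ((strictMono_levelRow w j).monotone hrm))

end Dominates

section ColumnSubset

variable {i j k r : Fin n}

theorem ColumnSubset.level_lt_level (h : ColumnSubset w k j) (hj : (i, j) ∈ rotheDiagram w)
    (hk : (i, k) ∉ rotheDiagram w) (hir : i < r) : level w (r, k) < level w (r, j) := by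
  classical
  calc level w (r, k) = Nat.count (ColumnRow w k) r := rfl
    _ < Nat.count (ColumnRow w j) r := by
      simp only [Nat.count_eq_card_filter_range]
      refine Finset.card_lt_card (Finset.ssubset_iff_of_subset ?_ |>.2 ⟨i, ?_, ?_⟩)
      · exact Finset.monotone_filter_right _ fun _ _ => h.columnRow
      · simpa using ⟨hir, columnRow_iff.2 hj⟩
      · simpa using fun _ => columnRow_iff.not.2 hk

theorem numBelow_eq_card (r j : Fin n) :
    numBelow w (r, j) = ((Finset.Ioi r).filter fun i => (i, j) ∈ rotheDiagram w).card := by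
  rw [numBelow]
  refine Finset.card_nbij' Prod.fst (fun i => (i, j)) ?_ ?_ ?_ ?_ <;> intro x <;> simp <;> grind

theorem ColumnSubset.numBelow_lt_numBelow (h : ColumnSubset w k j) (hj : (i, j) ∈ rotheDiagram w)
    (hk : (i, k) ∉ rotheDiagram w) (hri : r < i) : numBelow w (r, k) < numBelow w (r, j) := by
  simp only [numBelow_eq_card]
  refine Finset.card_lt_card (Finset.ssubset_iff_of_subset ?_ |>.2 ⟨i, ?_, ?_⟩)
  · exact Finset.monotone_filter_right _ fun _ _ => h _
  · simpa using ⟨hri, hj⟩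
  · simpa using fun _ => hk

theorem ColumnSubset.symm_of_not_prec (h : ColumnSubset w k j) (hr : (r, k) ∈ rotheDiagram w)
    (hlevel : level w (r, k) = level w (r, j)) (hprec : ¬ Prec w (r, k) (r, j)) :
    ColumnSubset w j k := by
  intro i hij
  by_contra hik
  rcases lt_trichotomy i r with hir | rfl | hri
  · exact (h.level_lt_level hij hik hir).ne hlevel
  · exact hik hr
  · exact hprec (Or.inr (Or.inl ⟨rfl, h.numBelow_lt_numBelow hij hik hri⟩))

end ColumnSubset

end RotheDiagram

section Selection

variable {n : ℕ} {w : Equiv.Perm (Fin n)}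

theorem prefix_foldl_selectStep (L A : List (Square n n)) : A <+: L.foldl (selectStep w) A := by
  induction L generalizing A with
  | nil => exact List.prefix_rfl
  | cons x L ih =>
    refine List.IsPrefix.trans ?_ (ih _)
    unfold selectStep
    split_ifs
    · exact List.prefix_rfl
    · exact List.prefix_append _ _

theorem foldl_selectStep_sublist (L A : List (Square n n)) :
    List.Sublist (L.foldl (selectStep w) A) (A ++ L) := by
  induction L generalizing A with
  | nil => simp
  | cons x L ih =>
    refine (ih _).trans ?_
    unfold selectStep
    split_ifs
    · exact (List.Sublist.refl A).append (List.sublist_cons_self x L)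
    · simp

theorem pairwise_foldl_selectStep (L A : List (Square n n))
    (hA : A.Pairwise fun a x => ¬ (a.2 = x.2 ∨ RotheLinked w a x)) :
    (L.foldl (selectStep w) A).Pairwise fun a x => ¬ (a.2 = x.2 ∨ RotheLinked w a x) := by
  induction L generalizing A with
  | nil => exact hA
  | cons x _ ih =>
    refine ih _ ?_
    unfold selectStep
    split_ifs with h
    · exact hA
    · refine List.pairwise_append.2 ⟨hA, List.pairwise_singleton _ _, fun a ha b hb hc => ?_⟩
      exact h ⟨a, ha, List.mem_singleton.1 hb ▸ hc⟩

theorem exists_mem_foldl_selectStep (L₁ L₂ : List (Square n n)) (x : Square n n) :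
    ∃ a ∈ (L₁ ++ x :: L₂).foldl (selectStep w) [], (a ∈ L₁ ∨ a = x) ∧
      (a.2 = x.2 ∨ RotheLinked w a x) := by
  rw [List.foldl_append, List.foldl_cons]
  have hpre := prefix_foldl_selectStep (w := w) L₂ (selectStep w (L₁.foldl (selectStep w) []) x)
  by_cases h : ∃ a ∈ L₁.foldl (selectStep w) [], a.2 = x.2 ∨ RotheLinked w a x
  · obtain ⟨a, ha, hax⟩ := h
    refine ⟨a, hpre.subset ?_, Or.inl ?_, hax⟩
    · rwa [selectStep, if_pos ⟨a, ha, hax⟩]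
    · simpa using (foldl_selectStep_sublist (w := w) L₁ []).subset ha
  · refine ⟨x, hpre.subset ?_, Or.inr rfl, Or.inl rfl⟩
    rw [selectStep, if_neg h]
    exact List.mem_append_right _ (List.mem_singleton_self x)

theorem distinguishedSquares_sublist :
    List.Sublist (distinguishedSquares w) ((rotheDiagram w).sort (PrecEq w)) := by
  simpa [distinguishedSquares] using
    foldl_selectStep_sublist (w := w) ((rotheDiagram w).sort (PrecEq w)) []

theorem mem_rotheDiagram_of_mem_distinguishedSquares {a : Square n n}
    (ha : a ∈ distinguishedSquares w) : a ∈ rotheDiagram w := by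
  simpa using distinguishedSquares_sublist.subset ha

theorem levelRow_level_of_mem_distinguishedSquares {a : Square n n}
    (ha : a ∈ distinguishedSquares w) : levelRow w a.2 (level w a) = a.1 :=
  levelRow_level (mem_rotheDiagram_of_mem_distinguishedSquares ha)

theorem pairwise_precEq_distinguishedSquares : (distinguishedSquares w).Pairwise (PrecEq w) :=
  ((rotheDiagram w).pairwise_sort (PrecEq w)).sublist distinguishedSquares_sublist

theorem pairwise_distinguishedSquares :
    (distinguishedSquares w).Pairwise fun a x => a.2 ≠ x.2 ∧ level w a ≠ level w x := by
  refine (pairwise_foldl_selectStep _ _ List.Pairwise.nil).imp_of_mem fun ha hx h => ?_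
  rwa [← not_or, ← rotheLinked_iff (mem_rotheDiagram_of_mem_distinguishedSquares ha)
    (mem_rotheDiagram_of_mem_distinguishedSquares hx)]

theorem eq_of_mem_distinguishedSquares {a b : Square n n} (ha : a ∈ distinguishedSquares w)
    (hb : b ∈ distinguishedSquares w) (hab : a.2 = b.2 ∨ level w a = level w b) : a = b := by
  by_contra hne
  have : Std.Symm fun a x : Square n n => a.2 ≠ x.2 ∧ level w a ≠ level w x :=
    ⟨fun _ _ h => ⟨h.1.symm, h.2.symm⟩⟩
  exact not_or.2 (pairwise_distinguishedSquares.forall ha hb hne) hab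

theorem exists_mem_distinguishedSquares {x : Square n n} (hx : x ∈ rotheDiagram w) :
    ∃ a ∈ distinguishedSquares w, PrecEq w a x ∧ (a.2 = x.2 ∨ level w a = level w x) := by
  obtain ⟨L₁, L₂, hL⟩ := List.append_of_mem
    (show x ∈ (rotheDiagram w).sort (PrecEq w) by simpa using hx)
  obtain ⟨a, ha, hax, hc⟩ := exists_mem_foldl_selectStep (w := w) L₁ L₂ x
  have ha' : a ∈ distinguishedSquares w := by
    rwa [distinguishedSquares, hL]
  refine ⟨a, ha', ?_,
    hc.imp_right (rotheLinked_iff (mem_rotheDiagram_of_mem_distinguishedSquares ha') hx).1⟩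
  obtain hax | rfl := hax
  · have h := (rotheDiagram w).pairwise_sort (PrecEq w)
    rw [hL, List.pairwise_append] at h
    exact h.2.2 a hax x List.mem_cons_self
  · exact Or.inl rfl

theorem PrecEq.row_le {x y : Square n n} (h : PrecEq w x y) : y.1 ≤ x.1 := by
  obtain rfl | h | h | h := h
  · exact le_rfl
  · exact h.le
  · exact h.1.ge
  · exact h.1.ge

theorem not_prec_of_precEq {x y : Square n n} (h : PrecEq w y x) : ¬ Prec w x y := by
  intro hxy
  obtain rfl := antisymm (r := PrecEq w) h (Or.inr hxy)
  simp [Prec] at hxy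

/-- A square of `D(w)` given by its column and its level, which moves do not change. -/
noncomputable def columnLevel (w : Equiv.Perm (Fin n)) (x : Square n n) : Fin n × ℕ :=
  (x.2, level w x)

/-- The distinguished squares, given by their columns and levels. -/
noncomputable def distinguishedLevels (w : Equiv.Perm (Fin n)) : List (Fin n × ℕ) :=
  (distinguishedSquares w).map (columnLevel w)

theorem mem_distinguishedLevels {j : Fin n} {m : ℕ} : (j, m) ∈ distinguishedLevels w ↔
    ∃ h : levelRow w j m < n, (⟨levelRow w j m, h⟩, j) ∈ distinguishedSquares w := by
  simp only [distinguishedLevels, List.mem_map, columnLevel, Prod.mk.injEq]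
  constructor
  · rintro ⟨a, ha, rfl, rfl⟩
    have h := levelRow_level_of_mem_distinguishedSquares ha
    refine ⟨h ▸ a.1.2, ?_⟩
    convert ha using 2
    exact Fin.ext h
  · rintro ⟨h, ha⟩
    exact ⟨_, ha, rfl, level_levelRow h⟩

theorem column_unique_of_mem_distinguishedLevels {j k : Fin n} {m : ℕ}
    (hj : (j, m) ∈ distinguishedLevels w) (hk : (k, m) ∈ distinguishedLevels w) : j = k := by
  obtain ⟨hjn, hj⟩ := mem_distinguishedLevels.1 hj
  obtain ⟨hkn, hk⟩ := mem_distinguishedLevels.1 hk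
  exact congrArg Prod.snd (eq_of_mem_distinguishedSquares hj hk
    (Or.inr ((level_levelRow hjn).trans (level_levelRow hkn).symm)))

theorem level_unique_of_mem_distinguishedLevels {j : Fin n} {m m' : ℕ}
    (hm : (j, m) ∈ distinguishedLevels w) (hm' : (j, m') ∈ distinguishedLevels w) : m = m' := by
  obtain ⟨hn, hm⟩ := mem_distinguishedLevels.1 hm
  obtain ⟨hn', hm'⟩ := mem_distinguishedLevels.1 hm'
  rw [← level_levelRow hn, eq_of_mem_distinguishedSquares hm hm' (Or.inl rfl), level_levelRow hn']

section GreedyStep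

variable {A₁ A₂ : List (Square n n)} {a b x : Square n n} {k : Fin n} {l : ℕ}

theorem mem_of_eq_append (hA : distinguishedSquares w = A₁ ++ a :: A₂) :
    a ∈ distinguishedSquares w :=
  hA ▸ List.mem_append_right _ List.mem_cons_self

theorem mem_of_mem_left (hA : distinguishedSquares w = A₁ ++ a :: A₂) (hb : b ∈ A₁) :
    b ∈ distinguishedSquares w :=
  hA ▸ List.mem_append_left _ hb

theorem prec_of_mem_left (hA : distinguishedSquares w = A₁ ++ a :: A₂) (hb : b ∈ A₁) :
    PrecEq w b a ∧ b.2 ≠ a.2 ∧ level w b ≠ level w a := by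
  have hprec := pairwise_precEq_distinguishedSquares (w := w)
  have hne := pairwise_distinguishedSquares (w := w)
  rw [hA, List.pairwise_append] at hprec hne
  exact ⟨hprec.2.2 b hb a List.mem_cons_self, hne.2.2 b hb a List.mem_cons_self⟩

theorem exists_mem_left_of_prec (hA : distinguishedSquares w = A₁ ++ a :: A₂)
    (hx : x ∈ rotheDiagram w) (hxa : Prec w x a) :
    ∃ b ∈ A₁, PrecEq w b x ∧ (b.2 = x.2 ∨ level w b = level w x) := by
  obtain ⟨b, hb, hbx, hc⟩ := exists_mem_distinguishedSquares hx
  refine ⟨b, ?_, hbx, hc⟩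
  have hprec := pairwise_precEq_distinguishedSquares (w := w)
  rw [hA, List.pairwise_append, List.pairwise_cons] at hprec
  have hab : ¬ PrecEq w a b := fun hab => not_prec_of_precEq (_root_.trans hab hbx) hxa
  rw [hA, List.mem_append, List.mem_cons] at hb
  refine hb.resolve_right fun hb => hab ?_
  exact hb.elim (fun hba => Or.inl hba.symm) (hprec.2.1.1 b)

theorem ne_of_isFree (hk : IsFree (A₁.map (columnLevel w)) k) (hb : b ∈ A₁) : b.2 ≠ k :=
  hk _ (List.mem_map_of_mem hb)

theorem not_prec_of_isFree (hA : distinguishedSquares w = A₁ ++ a :: A₂)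
    (hk : IsFree (A₁.map (columnLevel w)) k) (hkn : levelRow w k (level w a) < n) :
    ¬ Prec w (⟨levelRow w k (level w a), hkn⟩, k) a := by
  intro hprec
  obtain ⟨b, hb, -, hcol | hlevel⟩ :=
    exists_mem_left_of_prec hA (mem_rotheDiagram_levelRow hkn) hprec
  · exact ne_of_isFree hk hb hcol
  · exact (prec_of_mem_left hA hb).2.2 (hlevel.trans (level_levelRow hkn))

theorem Vexillary.columnSubset_of_isFree (hw : Vexillary w)
    (hA : distinguishedSquares w = A₁ ++ a :: A₂) (hk : IsFree (A₁.map (columnLevel w)) k)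
    (hkn : levelRow w k (level w a) < n) : ColumnSubset w a.2 k := by
  refine (hw.columnSubset_total a.2 k).elim id fun h => ?_
  have ha := levelRow_level_of_mem_distinguishedSquares (mem_of_eq_append hA)
  have hprec := not_prec_of_isFree hA hk hkn
  have hrow : (⟨levelRow w k (level w a), hkn⟩ : Fin n) = a.1 := by
    refine Fin.ext (((h.levelRow_le (level w a)).antisymm ?_).symm.trans ha)
    by_contra! hlt
    exact hprec (Or.inl (Fin.lt_def.2 (ha ▸ hlt)))
  have hmem := mem_rotheDiagram_levelRow hkn
  have hlevel := level_levelRow hkn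
  rw [hrow] at hprec hmem hlevel
  exact h.symm_of_not_prec hmem hlevel hprec

theorem exists_mem_left_of_lt (hA : distinguishedSquares w = A₁ ++ a :: A₂)
    (hk : IsFree (A₁.map (columnLevel w)) k) (hkn : levelRow w k l < n)
    (hlt : a.1 < levelRow w k l) :
    ∃ b ∈ A₁.map (columnLevel w), b.2 = l ∧ levelRow w k l ≤ levelRow w b.1 l := by
  obtain ⟨b, hb, hbx, hc⟩ :=
    exists_mem_left_of_prec hA (mem_rotheDiagram_levelRow hkn) (Or.inl (Fin.lt_def.2 hlt))
  have hlevel : level w b = l := (hc.resolve_left (ne_of_isFree hk hb)).trans (level_levelRow hkn)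
  have hrow := levelRow_level_of_mem_distinguishedSquares (mem_of_mem_left hA hb)
  refine ⟨_, List.mem_map_of_mem hb, hlevel, ?_⟩
  rw [hlevel] at hrow
  exact hrow ▸ hbx.row_le

theorem level_lt_or_le_levelRow (hA : distinguishedSquares w = A₁ ++ a :: A₂) (hb : b ∈ A₁) :
    level w a < level w b ∨ n ≤ levelRow w b.2 (level w a) := by
  obtain ⟨hba, -, hne⟩ := prec_of_mem_left hA hb
  by_contra! hc
  obtain ⟨hle, hn⟩ := hc
  have hbA : b ∈ distinguishedSquares w := mem_of_mem_left hA hb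
  have hrow := levelRow_level_of_mem_distinguishedSquares hbA
  have hlt : b.1 < levelRow w b.2 (level w a) :=
    hrow ▸ strictMono_levelRow w b.2 (hle.lt_of_ne hne)
  obtain ⟨c, hc, hcx, hcol | hlevel⟩ := exists_mem_left_of_prec hA (mem_rotheDiagram_levelRow hn)
    (Or.inl ((Fin.le_def.1 hba.row_le).trans_lt hlt))
  · obtain rfl := eq_of_mem_distinguishedSquares (mem_of_mem_left hA hc) hbA (Or.inl hcol)
    exact (Fin.le_def.1 hcx.row_le).not_gt hlt
  · exact (prec_of_mem_left hA hc).2.2 (hlevel.trans (level_levelRow hn))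

theorem Vexillary.isGreedyStep (hw : Vexillary w) (hA : distinguishedSquares w = A₁ ++ a :: A₂) :
    IsGreedyStep (levelRow w) n (A₁.map (columnLevel w)) a.2 (level w a) := by
  have ha := levelRow_level_of_mem_distinguishedSquares (mem_of_eq_append hA)
  have hn : levelRow w a.2 (level w a) < n := ha ▸ a.1.2
  have hfree : IsFree (A₁.map (columnLevel w)) a.2 :=
    List.forall_mem_map.2 fun b hb => (prec_of_mem_left hA hb).2.1
  refine ⟨hn, hfree, fun k _ hk hkn => hw.dominates (hw.columnSubset_of_isFree hA hk hkn) hn,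
    fun l hl hjl k hk hkl => ?_,
    List.forall_mem_map.2 fun b hb => level_lt_or_le_levelRow hA hb⟩
  have hlt : a.1 < levelRow w a.2 l := ha ▸ strictMono_levelRow w a.2 hl
  rcases lt_or_ge (a.1 : ℕ) (levelRow w k l) with hkl' | hkl'
  · exact exists_mem_left_of_lt hA hk hkl hkl'
  · obtain ⟨b, hb, hbl, hle⟩ := exists_mem_left_of_lt hA hfree hjl hlt
    exact ⟨b, hb, hbl, hkl'.trans (hlt.le.trans hle)⟩

theorem Vexillary.exists_isImprovement (hw : Vexillary w) {C : Fin n → Column}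
    (h : IsConfiguration (levelRow w) n C) :
    ∃ C', IsImprovement (levelRow w) n (distinguishedLevels w) C C' := by
  refine h.exists_isImprovement (strictMono_levelRow w) _ fun B j m R hB => ?_
  obtain ⟨A₁, A₂, hA, rfl, hmap⟩ := List.map_eq_append_iff.1 hB
  obtain ⟨a, A₃, rfl, ha, -⟩ := List.map_eq_cons_iff.1 hmap
  obtain ⟨rfl, rfl⟩ := Prod.mk.inj ha
  exact hw.isGreedyStep hA

end GreedyStep

/-- In a configuration that is full at all distinguished squares, the greedy selection leaves no
room for other dead squares: they would share a row and a level with a dead square of a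
distinguished column. -/
theorem IsConfiguration.dead_iff {C : Fin n → Column} (h : IsConfiguration (levelRow w) n C)
    (hfull : ∀ b ∈ distinguishedLevels w, (C b.1).IsFull b.2 (levelRow w b.1 b.2)) (j : Fin n)
    (l i : ℕ) :
    (C j).dead l i ↔ (j, l) ∈ distinguishedLevels w ∧ l < i ∧ i ≤ levelRow w j l := by
  refine ⟨fun hd => ?_, fun hd => ((hfull _ hd.1).dead_iff i).2 hd.2⟩
  have hn := (h.isAdmissible j).lt_of_dead hd
  obtain ⟨hli, hil, -⟩ := (h.isAdmissible j).dead_bounds _ _ hd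
  replace hli := ((h.isAdmissible j).self_le_row l).trans_lt hli
  obtain ⟨b, hb, hbx, hc⟩ := exists_mem_distinguishedSquares (mem_rotheDiagram_levelRow hn)
  rw [level_levelRow hn] at hc
  have hbA : (b.2, level w b) ∈ distinguishedLevels w := List.mem_map_of_mem hb
  have hle : levelRow w j l ≤ levelRow w b.2 (level w b) :=
    (levelRow_level_of_mem_distinguishedSquares hb).symm ▸ hbx.row_le
  have hlevel : level w b = l := by
    refine hc.elim (fun hcol => ?_) id
    obtain rfl : b.2 = j := hcol
    refine (((strictMono_levelRow w _).le_iff_le.1 hle).eq_or_lt.resolve_right fun hlt => ?_).symm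
    exact (hfull _ hbA).not_dead l i hlt hd
  rw [hlevel] at hbA hle
  have hd' : (C b.2).dead l i := ((hfull _ hbA).dead_iff i).2 ⟨hli, hil.trans hle⟩
  obtain rfl := h.dead_unique _ _ _ _ hd' hd
  exact ⟨hbA, hli, hil⟩

end Selection

namespace Column

variable {p : ℕ → ℕ} {n : ℕ} {c : Column} {l m i : ℕ}

/-- The column with live squares in the rows `p l` and without dead squares. -/
def ofRow (p : ℕ → ℕ) : Column := ⟨p, fun _ _ => False⟩

/-- The bubbling move at the live square of level `l`. -/
def bubble (c : Column) (l : ℕ) : Column where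
  row := Function.update c.row l (c.row l - 1)
  dead := c.dead

/-- The K-bubbling move at the live square of level `l`. -/
def kBubble (c : Column) (l : ℕ) : Column where
  row := Function.update c.row l (c.row l - 1)
  dead m i := c.dead m i ∨ m = l ∧ i = c.row l

/-- The live square of level `l` has room to move up by one row. -/
structure CanBubble (c : Column) (l : ℕ) : Prop where
  row_pos : 0 < c.row l
  not_occupied : ¬ c.Occupied (c.row l - 1)

/-- The inverse of the bubbling and K-bubbling moves at the live square of level `l`. -/
def lower (c : Column) (l : ℕ) : Column where
  row := Function.update c.row l (c.row l + 1)
  dead m i := c.dead m i ∧ ¬ (m = l ∧ i = c.row l + 1)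

theorem row_bubble_self : (c.bubble l).row l = c.row l - 1 := Function.update_self ..

theorem row_kBubble_self : (c.kBubble l).row l = c.row l - 1 := Function.update_self ..

theorem isAdmissible_ofRow (hp : StrictMono p) : (ofRow p).IsAdmissible p n where
  row_lt_row_succ _ := hp (Nat.lt_succ_self _)
  row_le _ := le_rfl
  row_eq _ _ := rfl
  dead_bounds _ _ h := h.elim

namespace IsAdmissible

theorem kBubble (h : c.IsAdmissible p n) (hn : c.row l < n) (hl : c.CanBubble l) :
    (c.kBubble l).IsAdmissible p n := by
  obtain ⟨hpos, hfree⟩ := hl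
  have hrow (m : ℕ) : c.row m ≠ c.row l - 1 := fun hm => hfree ⟨m, .inl hm⟩
  have hdead (m i : ℕ) (hd : c.dead m i) : i ≠ c.row l - 1 := fun hi => hfree ⟨m, .inr (hi ▸ hd)⟩
  dsimp only [Column.kBubble]
  constructor
  · intro m
    have := h.row_lt_row_succ m
    grind [Function.update_apply]
  · intro m
    have := h.row_le m
    grind [Function.update_apply]
  · intro m hm
    have := h.row_eq m hm
    grind [Function.update_apply]
  · intro m i hi
    have := h.dead_bounds m i
    have := h.row_lt_row_succ m
    have := h.row_le m
    grind [Function.update_apply]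

theorem bubble (h : c.IsAdmissible p n) (hn : c.row l < n) (hl : c.CanBubble l) :
    (c.bubble l).IsAdmissible p n :=
  have h' := h.kBubble hn hl
  ⟨h'.row_lt_row_succ, h'.row_le, h'.row_eq, fun m i hd => h'.dead_bounds m i (.inl hd)⟩

theorem occupied_bubble (h : c.IsAdmissible p n) :
    (c.bubble l).Occupied i ↔ i = c.row l - 1 ∨ i ≠ c.row l ∧ c.Occupied i := by
  have hlevel (m : ℕ) (hm : c.At m (c.row l)) : m = l := h.level_unique hm (.inl rfl)
  have hdead (m : ℕ) : ¬ c.dead m (c.row l) := h.not_dead_row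
  constructor
  · rintro ⟨m, hm⟩
    dsimp only [Occupied, At, Column.bubble] at *
    grind [Function.update_apply]
  · rintro (rfl | ⟨hi, m, hm⟩)
    · exact ⟨l, .inl (Function.update_self ..)⟩
    · refine ⟨m, hm.imp_left fun hm => ?_⟩
      have hml : m ≠ l := fun hml => hi (hml ▸ hm.symm)
      exact (Function.update_of_ne hml ..).trans hm

end IsAdmissible

theorem occupied_kBubble :
    (c.kBubble l).Occupied i ↔ i = c.row l - 1 ∨ c.Occupied i := by
  constructor
  · rintro ⟨m, hm⟩
    dsimp only [Occupied, At, kBubble] at *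
    grind [Function.update_apply]
  · rintro (rfl | ⟨m, hm⟩)
    · exact ⟨l, .inl (Function.update_self ..)⟩
    · refine ⟨m, ?_⟩
      dsimp only [At, kBubble] at *
      grind [Function.update_apply]

theorem at_of_at_bubble (h : (c.bubble l).At m i) (hi : i ≠ c.row l - 1) : c.At m i := by
  dsimp only [At, bubble] at *
  grind [Function.update_apply]

theorem at_of_at_kBubble (h : (c.kBubble l).At m i) (hi : i ≠ c.row l - 1) : c.At m i := by
  dsimp only [At, kBubble] at *
  grind [Function.update_apply]

theorem IsAdmissible.lower (h : c.IsAdmissible p n) (hp : StrictMono p) (hl : c.row l < p l)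
    (hl' : c.row (l + 1) = p (l + 1)) : (c.lower l).IsAdmissible p n := by
  have hpl := hp (Nat.lt_succ_self l)
  dsimp only [Column.lower]
  constructor
  · intro m
    have := h.row_lt_row_succ m
    grind [Function.update_apply]
  · intro m
    have := h.row_le m
    grind [Function.update_apply]
  · intro m hm
    have := h.row_eq m hm
    grind [Function.update_apply]
  · intro m i hi
    have := h.dead_bounds m i
    grind [Function.update_apply]

theorem IsAdmissible.canBubble_lower (h : c.IsAdmissible p n) : (c.lower l).CanBubble l where
  row_pos := by simp [Column.lower]
  not_occupied := by
    rintro ⟨m, hm⟩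
    have hlevel : c.At m (c.row l) → m = l := fun hm => h.level_unique hm (.inl rfl)
    have hdead : ¬ c.dead m (c.row l) := h.not_dead_row
    dsimp only [At, Column.lower] at *
    grind [Function.update_apply]

theorem bubble_lower (hd : ¬ c.dead l (c.row l + 1)) : (c.lower l).bubble l = c := by
  cases c
  simp only [lower, bubble, mk.injEq, Function.update_self, Function.update_idem,
    Nat.add_sub_cancel, Function.update_eq_self, true_and]
  grind

theorem kBubble_lower (hd : c.dead l (c.row l + 1)) : (c.lower l).kBubble l = c := by
  cases c
  simp only [lower, kBubble, mk.injEq, Function.update_self, Function.update_idem,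
    Nat.add_sub_cancel, Function.update_eq_self, true_and]
  grind

namespace IsAdmissible

theorem eq_ofRow (h : c.IsAdmissible p n) (hrow : ∀ l, c.row l = p l) : c = ofRow p := by
  have hdead (l i : ℕ) : ¬ c.dead l i := fun hd => by
    have := h.dead_bounds l i hd
    have := hrow l
    omega
  cases c
  simp only [ofRow, mk.injEq]
  exact ⟨funext hrow, by grind⟩

theorem exists_row_lt_of_ne_ofRow (h : c.IsAdmissible p n) (hp : StrictMono p)
    (hne : c ≠ ofRow p) : ∃ l, c.row l < p l ∧ c.row (l + 1) = p (l + 1) := by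
  by_contra! hsucc
  obtain ⟨l₀, hl₀⟩ : ∃ l, c.row l ≠ p l := by
    by_contra! hrow
    exact hne (h.eq_ofRow hrow)
  have hlt (l : ℕ) (hl : l₀ ≤ l) : c.row l < p l := by
    induction l, hl using Nat.le_induction with
    | base => exact (h.row_le l₀).lt_of_ne hl₀
    | succ l _ ih => exact (h.row_le _).lt_of_ne (hsucc l ih)
  exact (hlt _ (le_max_left l₀ n)).ne (h.row_eq _ ((le_max_right l₀ n).trans hp.le_apply))

end IsAdmissible

open Classical in
/-- The rank of the square in row `i`: the row minus the level, and `0` if there is no square. -/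
noncomputable def rank (c : Column) (i : ℕ) : ℕ :=
  if h : c.Occupied i then i - h.choose else 0

theorem IsAdmissible.rank_add_level (h : c.IsAdmissible p n) (hl : c.At l i) :
    c.rank i + l = i := by
  have hocc : c.Occupied i := ⟨l, hl⟩
  have hle := (h.self_le_row l).trans (h.bounds_of_at hl).1
  rw [rank, dif_pos hocc, h.level_unique hocc.choose_spec hl, Nat.sub_add_cancel hle]

theorem rank_of_not_occupied (h : ¬ c.Occupied i) : c.rank i = 0 := dif_neg h

end Column

section Configuration

variable {ι : Type*} {p : ι → ℕ → ℕ} {n : ℕ} {C : ι → Column} {j : ι} {l : ℕ}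

theorem isConfiguration_ofRow (hp : ∀ j, StrictMono (p j)) :
    IsConfiguration p n fun j => Column.ofRow (p j) where
  isAdmissible j := Column.isAdmissible_ofRow (hp j)
  dead_unique _ _ _ _ h := h.elim

variable [DecidableEq ι]

theorem IsConfiguration.bubble (hC : IsConfiguration p n C) (hn : (C j).row l < n)
    (hl : (C j).CanBubble l) : IsConfiguration p n (Function.update C j ((C j).bubble l)) :=
  hC.update ((hC.isAdmissible j).bubble hn hl) fun _ _ hd _ hx hd' =>
    hx (hC.dead_unique _ _ _ _ hd' hd)

theorem IsConfiguration.kBubble (hC : IsConfiguration p n C) (hn : (C j).row l < n)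
    (hl : (C j).CanBubble l) (hdead : ∀ x, ¬ (C x).dead l ((C j).row l)) :
    IsConfiguration p n (Function.update C j ((C j).kBubble l)) := by
  refine hC.update ((hC.isAdmissible j).kBubble hn hl) ?_
  rintro m i (hd | ⟨rfl, rfl⟩) x hx hd'
  · exact hx (hC.dead_unique _ _ _ _ hd' hd)
  · exact hdead x hd'

theorem IsConfiguration.lower (hC : IsConfiguration p n C) (hp : ∀ j, StrictMono (p j))
    (hl : (C j).row l < p j l) (hl' : (C j).row (l + 1) = p j (l + 1)) :
    IsConfiguration p n (Function.update C j ((C j).lower l)) :=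
  hC.update ((hC.isAdmissible j).lower (hp j) hl hl') fun _ _ hd _ hx hd' =>
    hx (hC.dead_unique _ _ _ _ hd' hd.1)

end Configuration

namespace BubblingDiagram

variable {n k : ℕ}

theorem ext_of_eq {𝒟 𝒟' : BubblingDiagram n k} (hD : 𝒟.D = 𝒟'.D) (hF : 𝒟.F = 𝒟'.F)
    (hr : ∀ x ∈ 𝒟.D, 𝒟.r x = 𝒟'.r x) : 𝒟 = 𝒟' := by
  have hr' : 𝒟.r = 𝒟'.r := by
    funext x
    by_cases hx : x ∈ 𝒟.D
    · exact hr x hx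
    · rw [𝒟.r_off x hx, 𝒟'.r_off x (hD ▸ hx)]
  cases 𝒟
  cases 𝒟'
  simp only at hD hF hr'
  subst hD hF hr'
  rfl

theorem BubblingMove.unique {𝒟 𝒟₁ 𝒟₂ : BubblingDiagram n k} {i : Fin n} {j : Fin k}
    (h₁ : BubblingMove 𝒟 i j 𝒟₁) (h₂ : BubblingMove 𝒟 i j 𝒟₂) : 𝒟₁ = 𝒟₂ := by
  obtain ⟨-, a, ha, -, hD₁, hr₁, hs₁, hF₁⟩ := h₁
  obtain ⟨-, b, hb, -, hD₂, hr₂, hs₂, hF₂⟩ := h₂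
  obtain rfl : a = b := Fin.ext (by omega)
  refine ext_of_eq (hD₁.trans hD₂.symm) (hF₁.trans hF₂.symm) fun x hx => ?_
  by_cases hxa : x = (a, j)
  · subst hxa; omega
  · rw [hs₁ x hx hxa, hs₂ x (by rw [hD₂, ← hD₁]; exact hx) hxa]

theorem KBubblingMove.unique {𝒟 𝒟₁ 𝒟₂ : BubblingDiagram n k} {i : Fin n} {j : Fin k}
    (h₁ : KBubblingMove 𝒟 i j 𝒟₁) (h₂ : KBubblingMove 𝒟 i j 𝒟₂) : 𝒟₁ = 𝒟₂ := by
  obtain ⟨-, -, a, ha, -, hD₁, hr₁, hs₁, hF₁⟩ := h₁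
  obtain ⟨-, -, b, hb, -, hD₂, hr₂, hs₂, hF₂⟩ := h₂
  obtain rfl : a = b := Fin.ext (by omega)
  refine ext_of_eq (hD₁.trans hD₂.symm) (hF₁.trans hF₂.symm) fun x hx => ?_
  by_cases hxa : x = (a, j)
  · subst hxa; omega
  · rw [hs₁ x hx hxa, hs₂ x (by rw [hD₂, ← hD₁]; exact hx) hxa]

theorem Move.exists_live_eq {𝒟 𝒟' : BubblingDiagram n k} (h : Move 𝒟 𝒟') :
    ∃ x ∈ 𝒟.live, ∃ y ∉ 𝒟.live, (y.1 : ℕ) + 1 = x.1 ∧ 𝒟'.live = insert y (𝒟.live.erase x) := by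
  obtain ⟨i, j, ⟨hlive, i', hi', hfree, hD, -, -, hF⟩ | ⟨hlive, -, i', hi', hfree, hD, -, -, hF⟩⟩ :=
    h
  all_goals
    refine ⟨(i, j), hlive, (i', j), fun h' => hfree (Finset.mem_sdiff.1 h').1, hi', ?_⟩
    have : i' ≠ i := by rintro rfl; omega
    have hF' := 𝒟.F_subset
    rw [live, hD, hF, live]
    ext x
    have := @hF' x
    grind

/-- The sum of the rows of the live squares, which decreases in each move. -/
def rowSum (𝒟 : BubblingDiagram n k) : ℕ := ∑ x ∈ 𝒟.live, (x.1 : ℕ)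

theorem rowSum_le (𝒟 : BubblingDiagram n k) : 𝒟.rowSum ≤ ∑ x : Square n k, (x.1 : ℕ) :=
  Finset.sum_le_sum_of_subset (Finset.subset_univ _)

theorem Move.rowSum_lt {𝒟 𝒟' : BubblingDiagram n k} (h : Move 𝒟 𝒟') :
    𝒟'.rowSum < 𝒟.rowSum := by
  obtain ⟨x, hx, y, hy, hyx, hlive⟩ := h.exists_live_eq
  have hy' : y ∉ 𝒟.live.erase x := fun h => hy (Finset.mem_of_mem_erase h)
  rw [rowSum, rowSum, hlive, Finset.sum_insert hy', ← Finset.add_sum_erase _ _ hx]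
  omega

theorem wellFounded_flip_move : WellFounded (flip (Move (n := n) (k := k))) :=
  Subrelation.wf (fun h => h.rowSum_lt) (measure rowSum).wf

theorem wellFounded_move : WellFounded (Move (n := n) (k := k)) := by
  refine Subrelation.wf (fun {𝒟 𝒟'} h => ?_)
    (measure fun 𝒟 : BubblingDiagram n k => ∑ x : Square n k, (x.1 : ℕ) - 𝒟.rowSum).wf
  have := 𝒟.rowSum_le
  exact Nat.sub_lt_sub_left (h.rowSum_lt.trans_le this) h.rowSum_lt

/-- The live squares of `𝒟` are the squares `((C j).row l, j)` inside the grid, its dead squares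
are given by the `(C j).dead`, and the rank of a square is its row minus its level. -/
structure Represents (𝒟 : BubblingDiagram n k) (C : Fin k → Column) : Prop where
  mem_D : ∀ (i : Fin n) j, (i, j) ∈ 𝒟.D ↔ (C j).Occupied i
  mem_F : ∀ (i : Fin n) j, (i, j) ∈ 𝒟.F ↔ ∃ l, (C j).dead l i
  rank : ∀ (i : Fin n) j l, (C j).At l i → 𝒟.r (i, j) + l = i

variable {p : Fin k → ℕ → ℕ} {C : Fin k → Column} {𝒟 𝒟' : BubblingDiagram n k}

theorem Represents.unique (h : 𝒟.Represents C) (h' : 𝒟'.Represents C) : 𝒟 = 𝒟' := by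
  refine ext_of_eq ?_ ?_ ?_
  · ext ⟨i, j⟩
    rw [h.mem_D, h'.mem_D]
  · ext ⟨i, j⟩
    rw [h.mem_F, h'.mem_F]
  · rintro ⟨i, j⟩ hx
    obtain ⟨l, hl⟩ := (h.mem_D i j).1 hx
    exact Nat.add_right_cancel ((h.rank i j l hl).trans (h'.rank i j l hl).symm)

theorem Represents.mem_live (h : 𝒟.Represents C) (hC : IsConfiguration p n C) {i : Fin n}
    {j : Fin k} : (i, j) ∈ 𝒟.live ↔ ∃ l, (C j).row l = i := by
  rw [live, Finset.mem_sdiff, h.mem_D, h.mem_F]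
  refine ⟨fun ⟨⟨l, hl⟩, hdead⟩ => ⟨l, hl.resolve_right fun hd => hdead ⟨l, hd⟩⟩, ?_⟩
  rintro ⟨l, hl⟩
  exact ⟨⟨l, .inl hl⟩, fun ⟨_, hd⟩ => (hC.isAdmissible j).not_dead_row (hl ▸ hd)⟩

theorem Represents.heightIndex_live (h : 𝒟.Represents C) (hC : IsConfiguration p n C) {i : Fin n}
    {j : Fin k} {l : ℕ} (hl : (C j).row l = i) : heightIndex 𝒟.live (i, j) = l + 1 := by
  have hmono := (hC.isAdmissible j).strictMono
  have hrow {m : ℕ} (hm : m ∈ Finset.range (l + 1)) : (C j).row m ≤ i :=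
    hl ▸ hmono.monotone (Finset.mem_range_succ_iff.1 hm)
  rw [← Finset.card_range (l + 1), heightIndex]
  refine (Finset.card_bij (fun m hm => (⟨(C j).row m, (hrow hm).trans_lt i.2⟩, j)) ?_ ?_ ?_).symm
  · intro m hm
    exact Finset.mem_filter.2 ⟨(h.mem_live hC).2 ⟨m, rfl⟩, rfl, hrow hm⟩
  · intro m _ m' _ heq
    exact hmono.injective (Fin.mk.inj (Prod.mk.inj heq).1)
  · rintro ⟨x, y⟩ hx
    obtain ⟨hlive, rfl, hxi⟩ := Finset.mem_filter.1 hx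
    obtain ⟨m, hm⟩ := (h.mem_live hC).1 hlive
    have hml : m ≤ l := hmono.le_iff_le.1 (hm.trans_le (Fin.le_def.1 hxi |>.trans_eq hl.symm))
    exact ⟨m, Finset.mem_range_succ_iff.2 hml, Prod.ext (Fin.ext hm) rfl⟩

theorem Represents.wt_apply (h : 𝒟.Represents C) (i : Fin n) : 𝒟.wt i = occupiedCount C i := by
  have hocc : {j | (C j).Occupied i} = ((𝒟.D.filter fun x => x.1 = i).image Prod.snd : Set _) := by
    ext j
    simp [← h.mem_D]
  rw [occupiedCount, hocc, Set.ncard_coe_finset, Finset.card_image_of_injOn]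
  · rfl
  · intro x hx y hy hxy
    exact Prod.ext ((Finset.mem_filter.1 hx).2.trans (Finset.mem_filter.1 hy).2.symm) hxy

open Classical in
/-- The bubbling diagram represented by a configuration. -/
noncomputable def ofConfiguration (hC : IsConfiguration p n C) : BubblingDiagram n k where
  D := Finset.univ.filter fun x => (C x.2).Occupied x.1
  r x := (C x.2).rank x.1
  F := Finset.univ.filter fun x => ∃ l, (C x.2).dead l x.1
  r_off x hx := Column.rank_of_not_occupied (by simpa using hx)
  F_subset _ hx := by
    obtain ⟨l, hl⟩ := (Finset.mem_filter_univ _).1 hx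
    exact (Finset.mem_filter_univ _).2 ⟨l, .inr hl⟩
  dead_below_live i j hij := by
    obtain ⟨l, hl⟩ := (Finset.mem_filter_univ _).1 hij
    have hj := hC.isAdmissible j
    obtain ⟨hli, -, hil⟩ := hj.dead_bounds l i hl
    refine ⟨⟨(C j).row l, hli.trans i.2⟩, hli, ?_, fun i' hi' hi'i => ?_, ?_⟩
    · simpa using ⟨⟨l, .inl rfl⟩, fun _ => hj.not_dead_row⟩
    · simp only [Finset.mem_sdiff, Finset.mem_filter_univ, not_and, not_not]
      rintro ⟨m, hm | hm⟩
      · have hml : m < l + 1 := hj.level_lt (.inl hm) ((Fin.lt_def.1 hi'i).trans hil)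
        have hlm : l < m := hj.strictMono.lt_iff_lt.1 ((Fin.lt_def.1 hi').trans_eq hm.symm)
        omega
      · exact ⟨m, hm⟩
    · have hdead : (C j).rank i + l = i := hj.rank_add_level (.inr hl)
      have hlive : (C j).rank ((C j).row l) + l = (C j).row l := hj.rank_add_level (.inl rfl)
      dsimp only
      omega
  dead_rank_ne i j j' hne hij hij' heq := by
    obtain ⟨l, hl⟩ := (Finset.mem_filter_univ _).1 hij
    obtain ⟨l', hl'⟩ := (Finset.mem_filter_univ _).1 hij'
    have hrank : (C j).rank i + l = i := (hC.isAdmissible j).rank_add_level (.inr hl)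
    have hrank' : (C j').rank i + l' = i := (hC.isAdmissible j').rank_add_level (.inr hl')
    obtain rfl : l = l' := Nat.add_left_cancel ((hrank.trans hrank'.symm).trans (heq ▸ rfl))
    exact hne (hC.dead_unique _ _ _ _ hl hl')

open Classical in
theorem represents_ofConfiguration (hC : IsConfiguration p n C) :
    (ofConfiguration hC).Represents C where
  mem_D _ _ := Finset.mem_filter_univ _
  mem_F _ _ := Finset.mem_filter_univ _
  rank _ j _ hl := (hC.isAdmissible j).rank_add_level hl

section Moves

variable {i : Fin n} {j : Fin k} {l : ℕ}

theorem Represents.bubblingMove (h : 𝒟.Represents C) (hC : IsConfiguration p n C)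
    (hi : (C j).row l = i) (hl : (C j).CanBubble l)
    (h' : 𝒟'.Represents (Function.update C j ((C j).bubble l))) : BubblingMove 𝒟 i j 𝒟' := by
  have hpos := hl.row_pos
  have hfree := hl.not_occupied
  rw [hi] at hpos hfree
  have hrow : ((C j).bubble l).row l = i - 1 := by rw [Column.row_bubble_self, hi]
  refine ⟨(h.mem_live hC).2 ⟨l, hi⟩, ⟨i - 1, by omega⟩, Nat.sub_add_cancel hpos, ?_, ?_, ?_, ?_, ?_⟩
  · rwa [h.mem_D]
  · ext ⟨x, y⟩
    rw [Finset.mem_insert, Finset.mem_erase, h.mem_D, h'.mem_D]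
    rcases eq_or_ne y j with rfl | hy
    · rw [Function.update_self, (hC.isAdmissible y).occupied_bubble, hi]
      simp [Fin.ext_iff]
    · simp [hy]
  · have := h.rank i j l (.inl hi)
    have := h'.rank ⟨i - 1, by omega⟩ j l (.inl (by rw [Function.update_self, hrow]))
    dsimp only at this
    omega
  · rintro ⟨x, y⟩ hx hne
    obtain ⟨m, hm⟩ := (h'.mem_D x y).1 hx
    refine Nat.add_right_cancel ((h'.rank x y m hm).trans (h.rank x y m ?_).symm)
    rcases eq_or_ne y j with rfl | hy
    · rw [Function.update_self] at hm
      exact Column.at_of_at_bubble hm fun hx => hne (Prod.ext (Fin.ext (by rw [hx, hi])) rfl)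
    · rwa [Function.update_of_ne hy] at hm
  · ext ⟨x, y⟩
    rw [h.mem_F, h'.mem_F]
    rcases eq_or_ne y j with rfl | hy
    · rw [Function.update_self, Column.bubble]
    · rw [Function.update_of_ne hy]

theorem Represents.kBubblingMove (h : 𝒟.Represents C) (hC : IsConfiguration p n C)
    (hi : (C j).row l = i) (hl : (C j).CanBubble l) (hdead : ∀ x, ¬ (C x).dead l i)
    (h' : 𝒟'.Represents (Function.update C j ((C j).kBubble l))) : KBubblingMove 𝒟 i j 𝒟' := by
  have hpos := hl.row_pos
  have hfree := hl.not_occupied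
  rw [hi] at hpos hfree
  have hrow : ((C j).kBubble l).row l = i - 1 := by rw [Column.row_kBubble_self, hi]
  refine ⟨(h.mem_live hC).2 ⟨l, hi⟩, fun x hx heq => ?_, ⟨i - 1, by omega⟩,
    Nat.sub_add_cancel hpos, ?_, ?_, ?_, ?_, ?_⟩
  · obtain ⟨m, hm⟩ := (h.mem_F i x).1 hx
    have := h.rank i j l (.inl hi)
    have := h.rank i x m (.inr hm)
    obtain rfl : m = l := by omega
    exact hdead x hm
  · rwa [h.mem_D]
  · ext ⟨x, y⟩
    rw [Finset.mem_insert, h.mem_D, h'.mem_D]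
    rcases eq_or_ne y j with rfl | hy
    · rw [Function.update_self, Column.occupied_kBubble, hi]
      simp [Fin.ext_iff]
    · simp [hy]
  · have := h.rank i j l (.inl hi)
    have := h'.rank ⟨i - 1, by omega⟩ j l (.inl (by rw [Function.update_self, hrow]))
    dsimp only at this
    omega
  · rintro ⟨x, y⟩ hx hne
    obtain ⟨m, hm⟩ := (h'.mem_D x y).1 hx
    refine Nat.add_right_cancel ((h'.rank x y m hm).trans (h.rank x y m ?_).symm)
    rcases eq_or_ne y j with rfl | hy
    · rw [Function.update_self] at hm
      exact Column.at_of_at_kBubble hm fun hx => hne (Prod.ext (Fin.ext (by rw [hx, hi])) rfl)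
    · rwa [Function.update_of_ne hy] at hm
  · ext ⟨x, y⟩
    rw [Finset.mem_insert, h.mem_F, h'.mem_F]
    rcases eq_or_ne y j with rfl | hy
    · rw [Function.update_self, Column.kBubble, hi]
      simp [Fin.ext_iff, exists_or, or_comm]
    · simp [hy]

theorem Represents.bubblingMove_iff (h : 𝒟.Represents C) (hC : IsConfiguration p n C) :
    BubblingMove 𝒟 i j 𝒟' ↔ ∃ l, (C j).row l = i ∧ (C j).CanBubble l ∧
      𝒟'.Represents (Function.update C j ((C j).bubble l)) := by
  refine ⟨fun hm => ?_, fun ⟨l, hi, hl, h'⟩ => h.bubblingMove hC hi hl h'⟩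
  obtain ⟨hlive, a, ha, hfree, -⟩ := id hm
  obtain ⟨l, hi⟩ := (h.mem_live hC).1 hlive
  have hl : (C j).CanBubble l := by
    refine ⟨by omega, ?_⟩
    rwa [hi, ← ha, Nat.add_sub_cancel, ← h.mem_D]
  have hrep := represents_ofConfiguration (hC.bubble (hi.trans_lt i.2) hl)
  obtain rfl := hm.unique (h.bubblingMove hC hi hl hrep)
  exact ⟨l, hi, hl, hrep⟩

theorem Represents.kBubblingMove_iff (h : 𝒟.Represents C) (hC : IsConfiguration p n C) :
    KBubblingMove 𝒟 i j 𝒟' ↔ ∃ l, (C j).row l = i ∧ (C j).CanBubble l ∧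
      (∀ x, ¬ (C x).dead l i) ∧ 𝒟'.Represents (Function.update C j ((C j).kBubble l)) := by
  refine ⟨fun hm => ?_, fun ⟨l, hi, hl, hdead, h'⟩ => h.kBubblingMove hC hi hl hdead h'⟩
  obtain ⟨hlive, hrank, a, ha, hfree, -⟩ := id hm
  obtain ⟨l, hi⟩ := (h.mem_live hC).1 hlive
  have hl : (C j).CanBubble l := by
    refine ⟨by omega, ?_⟩
    rwa [hi, ← ha, Nat.add_sub_cancel, ← h.mem_D]
  have hdead (x : Fin k) (hd : (C x).dead l i) : False :=
    hrank x ((h.mem_F i x).2 ⟨l, hd⟩)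
      (Nat.add_right_cancel ((h.rank i j l (.inl hi)).trans (h.rank i x l (.inr hd)).symm))
  have hrep := represents_ofConfiguration (hC.kBubble (hi.trans_lt i.2) hl (hi ▸ hdead))
  obtain rfl := hm.unique (h.kBubblingMove hC hi hl hdead hrep)
  exact ⟨l, hi, hl, hdead, hrep⟩

end Moves

theorem Represents.exists_of_move (h : 𝒟.Represents C) (hC : IsConfiguration p n C)
    (hm : Move 𝒟 𝒟') : ∃ C', IsConfiguration p n C' ∧ 𝒟'.Represents C' := by
  obtain ⟨i, j, hm | hm⟩ := hm
  · obtain ⟨l, hi, hl, h'⟩ := (h.bubblingMove_iff hC).1 hm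
    exact ⟨_, hC.bubble (hi.trans_lt i.2) hl, h'⟩
  · obtain ⟨l, hi, hl, hdead, h'⟩ := (h.kBubblingMove_iff hC).1 hm
    exact ⟨_, hC.kBubble (hi.trans_lt i.2) hl (hi ▸ hdead), h'⟩

theorem Represents.exists_of_mem_BD (h : 𝒟.Represents C) (hC : IsConfiguration p n C)
    (hm : 𝒟' ∈ BD 𝒟) : ∃ C', IsConfiguration p n C' ∧ 𝒟'.Represents C' := by
  induction hm with
  | refl => exact ⟨C, hC, h⟩
  | tail _ hm ih =>
    obtain ⟨C₁, hC₁, h₁⟩ := ih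
    exact h₁.exists_of_move hC₁ hm

theorem Represents.exists_move_to (h : 𝒟.Represents C) (hC : IsConfiguration p n C)
    (hp : ∀ j, StrictMono (p j)) {j : Fin k} (hne : C j ≠ Column.ofRow (p j)) :
    ∃ C' 𝒟', IsConfiguration p n C' ∧ 𝒟'.Represents C' ∧ Move 𝒟' 𝒟 := by
  have hj := hC.isAdmissible j
  obtain ⟨l, hlt, heq⟩ := hj.exists_row_lt_of_ne_ofRow (hp j) hne
  have hn : (C j).row l + 1 < n := by
    have := mt (hj.row_eq l) hlt.ne
    omega
  have hC' := hC.lower hp hlt heq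
  have h' := represents_ofConfiguration hC'
  refine ⟨_, _, hC', h', ⟨(C j).row l + 1, hn⟩, j, ?_⟩
  have hi : ((C j).lower l).row l = (C j).row l + 1 := Function.update_self ..
  by_cases hd : (C j).dead l ((C j).row l + 1)
  · refine .inr (h'.kBubblingMove hC' (l := l) ?_ ?_ (fun x => ?_) ?_)
    · rwa [Function.update_self]
    · rw [Function.update_self]
      exact hj.canBubble_lower
    · rcases eq_or_ne x j with rfl | hx
      · rw [Function.update_self]
        exact fun hd' => hd'.2 ⟨rfl, rfl⟩
      · rw [Function.update_of_ne hx]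
        exact fun hd' => hx (hC.dead_unique _ _ _ _ hd' hd)
    · rwa [Function.update_idem, Function.update_self, Column.kBubble_lower hd,
        Function.update_eq_self]
  · refine .inl (h'.bubblingMove hC' (l := l) ?_ ?_ ?_)
    · rwa [Function.update_self]
    · rw [Function.update_self]
      exact hj.canBubble_lower
    · rwa [Function.update_idem, Function.update_self, Column.bubble_lower hd,
        Function.update_eq_self]

/-- Every configuration is reached, since moves can be undone until the initial one is reached. -/
theorem Represents.mem_BD {𝒟₀ : BubblingDiagram n k}
    (h₀ : 𝒟₀.Represents fun j => Column.ofRow (p j)) (hp : ∀ j, StrictMono (p j))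
    (h : 𝒟.Represents C) (hC : IsConfiguration p n C) : 𝒟 ∈ BD 𝒟₀ := by
  induction 𝒟 using wellFounded_move.induction generalizing C with
  | _ 𝒟 ih =>
  by_cases hrow : ∀ j, C j = Column.ofRow (p j)
  · obtain rfl : C = fun j => Column.ofRow (p j) := funext hrow
    obtain rfl := h.unique h₀
    exact .refl
  · push Not at hrow
    obtain ⟨j, hne⟩ := hrow
    obtain ⟨C', 𝒟', hC', h', hm⟩ := h.exists_move_to hC hp hne
    exact .tail (ih 𝒟' hm h' hC') hm

end BubblingDiagram

theorem Column.IsAdmissible.canBubble {p : ℕ → ℕ} {n l : ℕ} {c : Column}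
    (h : c.IsAdmissible p n) (hl : l < c.row l) (hrow : ∀ m < l, c.row m = m)
    (hdead : ∀ m < l, ∀ i, ¬ c.dead m i) : c.CanBubble l where
  row_pos := (Nat.zero_le l).trans_lt hl
  not_occupied := by
    rintro ⟨m, hm⟩
    have hml : m < l := h.level_lt hm (by omega)
    have := hrow m hml
    have := hm.resolve_right (hdead m hml _)
    omega

theorem exists_reflTransGen_forall_not {α : Type*} {r : α → α → Prop}
    (hr : WellFounded (flip r)) (a : α) : ∃ b, Relation.ReflTransGen r a b ∧ ∀ c, ¬ r b c := by
  induction a using hr.induction with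
  | _ a ih =>
  by_cases ha : ∃ b, r a b
  · obtain ⟨b, hab⟩ := ha
    obtain ⟨c, hbc, hc⟩ := ih b hab
    exact ⟨c, .head hab hbc, hc⟩
  · exact ⟨a, .refl, not_exists.1 ha⟩

section TopDiagram

open BubblingDiagram

variable {n : ℕ} {w : Equiv.Perm (Fin n)} {C : Fin n → Column} {𝒟 𝒟' : BubblingDiagram n n}
  {j : Fin n} {l m : ℕ}

theorem isConfiguration_levelRow (w : Equiv.Perm (Fin n)) :
    IsConfiguration (levelRow w) n fun j => Column.ofRow (levelRow w j) :=
  isConfiguration_ofRow (strictMono_levelRow w)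

theorem represents_rotheBubblingDiagram (w : Equiv.Perm (Fin n)) :
    (rotheBubblingDiagram w).Represents fun j => Column.ofRow (levelRow w j) := by
  have hmem {i j : Fin n} {l : ℕ} (hl : levelRow w j l = i) :
      (i, j) ∈ rotheDiagram w ∧ level w (i, j) = l := by
    have hn : levelRow w j l < n := hl.trans_lt i.2
    obtain rfl : (⟨levelRow w j l, hn⟩ : Fin n) = i := Fin.ext hl
    exact ⟨mem_rotheDiagram_levelRow hn, level_levelRow hn⟩
  refine ⟨fun i j => ⟨fun hij => ⟨_, .inl (levelRow_level hij)⟩, ?_⟩, fun i j => ?_, ?_⟩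
  · rintro ⟨l, hl | hl⟩
    · exact (hmem hl).1
    · exact hl.elim
  · simp [rotheBubblingDiagram, Column.ofRow]
  · rintro i j l (hl | hl)
    · obtain ⟨hij, rfl⟩ := hmem hl
      simpa [rotheBubblingDiagram, hij] using rotheRank_add_level hij
    · exact hl.elim

theorem heightIndex_rotheDiagram {x : Square n n} (hx : x ∈ rotheDiagram w) :
    heightIndex (rotheDiagram w) x = level w x + 1 := by
  simpa [live, rotheBubblingDiagram] using (represents_rotheBubblingDiagram w).heightIndex_live
    (isConfiguration_levelRow w) (levelRow_level hx)

theorem isDistinguished_iff (h : 𝒟.Represents C) (hC : IsConfiguration (levelRow w) n C)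
    {i : Fin n} : IsDistinguished w 𝒟 (i, j) ↔
      ∃ m, (j, m) ∈ distinguishedLevels w ∧ (C j).row m = i := by
  have hidx {a : Square n n} (ha : a ∈ distinguishedSquares w) :
      heightIndex (rotheDiagram w) a = level w a + 1 :=
    heightIndex_rotheDiagram (mem_rotheDiagram_of_mem_distinguishedSquares ha)
  rw [IsDistinguished, h.mem_live hC]
  constructor
  · rintro ⟨⟨l, hl⟩, a, ha, rfl, heq⟩
    rw [h.heightIndex_live hC hl, hidx ha] at heq
    obtain rfl : l = level w a := Nat.add_right_cancel heq
    exact ⟨_, List.mem_map_of_mem ha, hl⟩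
  · rintro ⟨m, hm, hmi⟩
    obtain ⟨hn, ha⟩ := mem_distinguishedLevels.1 hm
    exact ⟨⟨m, hmi⟩, _, ha, rfl, by rw [h.heightIndex_live hC hmi, hidx ha, level_levelRow hn]⟩

theorem row_lt_of_mem_distinguishedLevels (hC : IsConfiguration (levelRow w) n C)
    (hm : (j, m) ∈ distinguishedLevels w) : (C j).row m < n :=
  ((hC.isAdmissible j).row_le m).trans_lt (mem_distinguishedLevels.1 hm).1

theorem topBubblingStep_iff (h : 𝒟.Represents C) (hC : IsConfiguration (levelRow w) n C) :
    TopBubblingStep w 𝒟 𝒟' ↔ ∃ j l m, (j, m) ∈ distinguishedLevels w ∧ l < m ∧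
      (C j).CanBubble l ∧ 𝒟'.Represents (Function.update C j ((C j).bubble l)) := by
  constructor
  · rintro ⟨i, j, ⟨i₀, hi₀, hd⟩, hmove⟩
    obtain ⟨m, hm, hmi⟩ := (isDistinguished_iff h hC).1 hd
    obtain ⟨l, hl, hbub, h'⟩ := (h.bubblingMove_iff hC).1 hmove
    refine ⟨j, l, m, hm, (hC.isAdmissible j).strictMono.lt_iff_lt.1 ?_, hbub, h'⟩
    rwa [hl, hmi]
  · rintro ⟨j, l, m, hm, hlm, hbub, h'⟩
    have hlt := (hC.isAdmissible j).strictMono hlm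
    have hn := row_lt_of_mem_distinguishedLevels hC hm
    exact ⟨⟨_, hlt.trans hn⟩, j, ⟨⟨_, hn⟩, hlt, (isDistinguished_iff h hC).2 ⟨m, hm, rfl⟩⟩,
      (h.bubblingMove_iff hC).2 ⟨l, rfl, hbub, h'⟩⟩

theorem topKBubblingStep_iff (h : 𝒟.Represents C) (hC : IsConfiguration (levelRow w) n C) :
    TopKBubblingStep w 𝒟 𝒟' ↔ ∃ j m, (j, m) ∈ distinguishedLevels w ∧ (C j).CanBubble m ∧
      (∀ x, ¬ (C x).dead m ((C j).row m)) ∧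
      𝒟'.Represents (Function.update C j ((C j).kBubble m)) := by
  constructor
  · rintro ⟨i, j, hd, hmove⟩
    obtain ⟨m, hm, hmi⟩ := (isDistinguished_iff h hC).1 hd
    obtain ⟨l, hl, hbub, hdead, h'⟩ := (h.kBubblingMove_iff hC).1 hmove
    obtain rfl : l = m := (hC.isAdmissible j).strictMono.injective (hl.trans hmi.symm)
    exact ⟨j, l, hm, hbub, hl ▸ hdead, h'⟩
  · rintro ⟨j, m, hm, hbub, hdead, h'⟩
    have hn := row_lt_of_mem_distinguishedLevels hC hm
    exact ⟨⟨_, hn⟩, j, (isDistinguished_iff h hC).2 ⟨m, hm, rfl⟩,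
      (h.kBubblingMove_iff hC).2 ⟨m, rfl, hbub, hdead, h'⟩⟩

/-- The configurations in the first phase of the construction of `𝒟^⊤(w)`: only live squares above
distinguished ones have moved, and there are no dead squares. -/
structure IsFirstPhase (w : Equiv.Perm (Fin n)) (C : Fin n → Column) : Prop where
  isConfiguration : IsConfiguration (levelRow w) n C
  not_dead : ∀ j l i, ¬ (C j).dead l i
  row_eq : ∀ j l, (∀ m, (j, m) ∈ distinguishedLevels w → m ≤ l) → (C j).row l = levelRow w j l

/-- The configurations in the second phase of the construction of `𝒟^⊤(w)`: the live squares above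
distinguished ones are at the top, and the distinguished ones have moved up by K-bubbling moves. -/
structure IsSecondPhase (w : Equiv.Perm (Fin n)) (C : Fin n → Column) : Prop where
  isConfiguration : IsConfiguration (levelRow w) n C
  row_eq_self : ∀ j l m, (j, m) ∈ distinguishedLevels w → l < m → (C j).row l = l
  row_eq : ∀ j l, (∀ m, (j, m) ∈ distinguishedLevels w → m < l) → (C j).row l = levelRow w j l
  dead_iff : ∀ j l i, (C j).dead l i ↔
    (j, l) ∈ distinguishedLevels w ∧ (C j).row l < i ∧ i ≤ levelRow w j l

open Classical in
/-- The column `j` of `𝒟^⊤(w)`. -/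
noncomputable def topColumn (w : Equiv.Perm (Fin n)) (j : Fin n) : Column where
  row l := if ∃ m, l ≤ m ∧ (j, m) ∈ distinguishedLevels w then l else levelRow w j l
  dead l i := (j, l) ∈ distinguishedLevels w ∧ l < i ∧ i ≤ levelRow w j l

theorem isFirstPhase_levelRow (w : Equiv.Perm (Fin n)) :
    IsFirstPhase w fun j => Column.ofRow (levelRow w j) :=
  ⟨isConfiguration_levelRow w, fun _ _ _ h => h, fun _ _ _ => rfl⟩

theorem IsFirstPhase.bubble (h : IsFirstPhase w C) (hm : (j, m) ∈ distinguishedLevels w)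
    (hlm : l < m) (hl : (C j).CanBubble l) :
    IsFirstPhase w (Function.update C j ((C j).bubble l)) where
  isConfiguration := h.isConfiguration.bubble
    (((h.isConfiguration.isAdmissible j).strictMono hlm).trans
      (row_lt_of_mem_distinguishedLevels h.isConfiguration hm)) hl
  not_dead x y i := by
    rcases eq_or_ne x j with rfl | hx
    · rw [Function.update_self]
      exact h.not_dead x y i
    · rw [Function.update_of_ne hx]
      exact h.not_dead x y i
  row_eq x y hxy := by
    rcases eq_or_ne x j with rfl | hx
    · rw [Function.update_self]
      exact (Function.update_of_ne (hlm.trans_le (hxy m hm)).ne' _ _).trans (h.row_eq x y hxy)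
    · rw [Function.update_of_ne hx]
      exact h.row_eq x y hxy

theorem IsFirstPhase.isSecondPhase (h : IsFirstPhase w C)
    (hmax : ∀ j l m, (j, m) ∈ distinguishedLevels w → l < m → ¬ (C j).CanBubble l) :
    IsSecondPhase w C where
  isConfiguration := h.isConfiguration
  row_eq_self j l m hm hlm := by
    induction l using Nat.strong_induction_on with
    | _ l ih =>
    have hj := h.isConfiguration.isAdmissible j
    by_contra hne
    exact hmax j l m hm hlm (hj.canBubble ((hj.self_le_row l).lt_of_ne' hne)
      (fun k hk => ih k hk (hk.trans hlm)) fun k _ => h.not_dead j k)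
  row_eq j l hl := h.row_eq j l fun m hm => (hl m hm).le
  dead_iff j l i := by
    refine iff_of_false (h.not_dead j l i) ?_
    rintro ⟨hl, hlt, hle⟩
    have := h.row_eq j l fun m hm => (level_unique_of_mem_distinguishedLevels hm hl).le
    omega

theorem IsSecondPhase.not_dead_row (h : IsSecondPhase w C)
    (hm : (j, m) ∈ distinguishedLevels w) (x : Fin n) : ¬ (C x).dead m ((C j).row m) := by
  intro hd
  obtain rfl := column_unique_of_mem_distinguishedLevels ((h.dead_iff x m _).1 hd).1 hm
  exact (h.isConfiguration.isAdmissible x).not_dead_row hd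

theorem IsSecondPhase.kBubble (h : IsSecondPhase w C) (hm : (j, m) ∈ distinguishedLevels w)
    (hl : (C j).CanBubble m) : IsSecondPhase w (Function.update C j ((C j).kBubble m)) where
  isConfiguration := h.isConfiguration.kBubble
    (row_lt_of_mem_distinguishedLevels h.isConfiguration hm) hl (h.not_dead_row hm)
  row_eq_self x l m' hm' hlm' := by
    rcases eq_or_ne x j with rfl | hx
    · obtain rfl := level_unique_of_mem_distinguishedLevels hm hm'
      rw [Function.update_self]
      exact (Function.update_of_ne hlm'.ne _ _).trans (h.row_eq_self x l m hm hlm')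
    · rw [Function.update_of_ne hx]
      exact h.row_eq_self x l m' hm' hlm'
  row_eq x l hml := by
    rcases eq_or_ne x j with rfl | hx
    · rw [Function.update_self]
      exact (Function.update_of_ne (hml m hm).ne' _ _).trans (h.row_eq x l hml)
    · rw [Function.update_of_ne hx]
      exact h.row_eq x l hml
  dead_iff x l i := by
    have hd := h.dead_iff x l i
    rcases eq_or_ne x j with rfl | hx
    · have := hl.row_pos
      have := (h.isConfiguration.isAdmissible x).row_le m
      rw [Function.update_self]
      dsimp only [Column.kBubble]
      grind [Function.update_apply]
    · rwa [Function.update_of_ne hx]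

theorem IsSecondPhase.eq_topColumn (h : IsSecondPhase w C)
    (hmax : ∀ j m, (j, m) ∈ distinguishedLevels w → ¬ (C j).CanBubble m) : C = topColumn w := by
  have hrow {j : Fin n} {m : ℕ} (hm : (j, m) ∈ distinguishedLevels w) : (C j).row m = m := by
    have hj := h.isConfiguration.isAdmissible j
    by_contra hne
    refine hmax j m hm (hj.canBubble ((hj.self_le_row m).lt_of_ne' hne)
      (fun k hk => h.row_eq_self j k m hm hk) fun k hk i hd => hk.ne ?_)
    exact level_unique_of_mem_distinguishedLevels ((h.dead_iff j k i).1 hd).1 hm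
  funext j
  ext l i
  · unfold topColumn
    dsimp only
    split_ifs with hex
    · obtain ⟨m, hlm, hm⟩ := hex
      rcases hlm.eq_or_lt with rfl | hlm
      · exact hrow hm
      · exact h.row_eq_self j l m hm hlm
    · exact h.row_eq j l fun m hm => not_le.1 fun hlm => hex ⟨m, hlm, hm⟩
  · rw [h.dead_iff]
    exact and_congr_right fun hl => by rw [hrow hl]

theorem IsFirstPhase.exists_of_reflTransGen (hC : IsFirstPhase w C) (h : 𝒟.Represents C)
    (hs : Relation.ReflTransGen (TopBubblingStep w) 𝒟 𝒟') :
    ∃ C', IsFirstPhase w C' ∧ 𝒟'.Represents C' := by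
  induction hs with
  | refl => exact ⟨C, hC, h⟩
  | tail _ hstep ih =>
    obtain ⟨C₁, hC₁, h₁⟩ := ih
    obtain ⟨j, l, m, hm, hlm, hl, h₂⟩ := (topBubblingStep_iff h₁ hC₁.isConfiguration).1 hstep
    exact ⟨_, hC₁.bubble hm hlm hl, h₂⟩

theorem IsSecondPhase.exists_of_reflTransGen (hC : IsSecondPhase w C) (h : 𝒟.Represents C)
    (hs : Relation.ReflTransGen (TopKBubblingStep w) 𝒟 𝒟') :
    ∃ C', IsSecondPhase w C' ∧ 𝒟'.Represents C' := by
  induction hs with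
  | refl => exact ⟨C, hC, h⟩
  | tail _ hstep ih =>
    obtain ⟨C₁, hC₁, h₁⟩ := ih
    obtain ⟨j, m, hm, hl, -, h₂⟩ := (topKBubblingStep_iff h₁ hC₁.isConfiguration).1 hstep
    exact ⟨_, hC₁.kBubble hm hl, h₂⟩

theorem IsFirstPhase.isSecondPhase_of_forall_not (hC : IsFirstPhase w C) (h : 𝒟.Represents C)
    (hmax : ∀ 𝒟', ¬ TopBubblingStep w 𝒟 𝒟') : IsSecondPhase w C :=
  hC.isSecondPhase fun _ _ _ hm hlm hl => hmax _ <|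
    (topBubblingStep_iff h hC.isConfiguration).2
      ⟨_, _, _, hm, hlm, hl, represents_ofConfiguration (hC.bubble hm hlm hl).isConfiguration⟩

theorem IsSecondPhase.eq_topColumn_of_forall_not (hC : IsSecondPhase w C) (h : 𝒟.Represents C)
    (hmax : ∀ 𝒟', ¬ TopKBubblingStep w 𝒟 𝒟') : C = topColumn w :=
  hC.eq_topColumn fun _ _ hm hl => hmax _ <|
    (topKBubblingStep_iff h hC.isConfiguration).2
      ⟨_, _, hm, hl, hC.not_dead_row hm,
        represents_ofConfiguration (hC.kBubble hm hl).isConfiguration⟩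

theorem IsTopDiagram.represents (h : IsTopDiagram w 𝒟) : 𝒟.Represents (topColumn w) := by
  obtain ⟨ℰ, hsteps, hmax, hksteps, hkmax⟩ := h
  obtain ⟨C, hC, hℰ⟩ := (isFirstPhase_levelRow w).exists_of_reflTransGen
    (represents_rotheBubblingDiagram w) hsteps
  obtain ⟨C', hC', h⟩ := (hC.isSecondPhase_of_forall_not hℰ hmax).exists_of_reflTransGen hℰ hksteps
  rwa [hC'.eq_topColumn_of_forall_not h hkmax] at h

theorem existsUnique_isTopDiagram (w : Equiv.Perm (Fin n)) : ∃! 𝒯, IsTopDiagram w 𝒯 := by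
  obtain ⟨ℰ, hsteps, hmax⟩ := exists_reflTransGen_forall_not (r := TopBubblingStep w)
    (Subrelation.wf (fun ⟨i, j, _, hmove⟩ => ⟨i, j, .inl hmove⟩) wellFounded_flip_move)
    (rotheBubblingDiagram w)
  obtain ⟨𝒯, hksteps, hkmax⟩ := exists_reflTransGen_forall_not (r := TopKBubblingStep w)
    (Subrelation.wf (fun ⟨i, j, _, hmove⟩ => ⟨i, j, .inr hmove⟩) wellFounded_flip_move) ℰ
  have h𝒯 : IsTopDiagram w 𝒯 := ⟨ℰ, hsteps, hmax, hksteps, hkmax⟩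
  exact ⟨𝒯, h𝒯, fun 𝒯' h' => h'.represents.unique h𝒯.represents⟩

end TopDiagram

theorem theorem3 {n : ℕ} (w : Equiv.Perm (Fin n)) (hw : Vexillary w) :
    (∃! 𝒯 : BubblingDiagram n n, IsTopDiagram w 𝒯) ∧
    ∀ 𝒯 : BubblingDiagram n n, IsTopDiagram w 𝒯 →
      ∀ 𝒟 ∈ bubblingDiagrams w, ∃ 𝒟' ∈ bubblingDiagrams w,
        𝒟'.F = 𝒯.F ∧
        (MvPolynomial.monomial 𝒟.wt (1 : ℤ)) ∣ (MvPolynomial.monomial 𝒟'.wt (1 : ℤ)) := by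
  refine ⟨existsUnique_isTopDiagram w, fun 𝒯 h𝒯 𝒟 h𝒟 => ?_⟩
  obtain ⟨C, hC, hrep⟩ := (represents_rotheBubblingDiagram w).exists_of_mem_BD
    (isConfiguration_levelRow w) h𝒟
  obtain ⟨C', hC', hfull, hle⟩ := hw.exists_isImprovement hC
  have hrep' := BubblingDiagram.represents_ofConfiguration hC'
  refine ⟨BubblingDiagram.ofConfiguration hC', (represents_rotheBubblingDiagram w).mem_BD
    (strictMono_levelRow w) hrep' hC', ?_, ?_⟩
  · ext ⟨i, j⟩
    rw [hrep'.mem_F, h𝒯.represents.mem_F]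
    exact exists_congr fun l => hC'.dead_iff hfull j l i
  · refine MvPolynomial.monomial_dvd_monomial.2 ⟨.inr fun i => ?_, one_dvd _⟩
    rw [hrep.wt_apply, hrep'.wt_apply]
    exact hle i
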